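/- Let $n\ge 0$, let $a_1,\dots,a_n$ be positive integers and $N=a_1+\dots+a_n$, and write $x=(x_1,\dots,x_n)\in\mathbb R^N=\mathbb R^{a_1}\oplus\cdots\oplus\mathbb R^{a_n}$ with $x_k\in\mathbb R^{a_k}$; let $|x_k|$ be the Euclidean norm of $x_k$. Let $1\le d_1\le d_2\le\cdots\le d_n$ be integers (for instance $d_k=k$). Let $G$ be a homogeneous nilpotent Lie group with underlying manifold $\mathbb R^N$, i.e. $\mathbb R^N$ with a smooth group law $(x,y)\mapsto xy$ (and smooth inversion) for which the dilations $\delta_r(x)=(r^{d_1}x_1,\dots,r^{d_n}x_n)$, $r>0$, are automorphisms. (Nilpotency then holds automatically.) Let $m$ (or $dy$) be Lebesgue measure on $\mathbb R^N$, and $L^p(G)=L^p(\mathbb R^N,m)$. For $s=(s_1,\dots,s_n)$ with all $s_k>0$ put $$R_s=\{x\in\mathbb R^N:\ |x_k|\le s_k^{d_k}\ \text{ for } k=1,\dots,n\},$$ and call $s$ acceptable if $s_1\le s_2\le\cdots\le s_n$. For a measurable scalar-valued (real or complex) function $f$ on $G$ define $$M(f)(x)=\sup_{s\ \text{acceptable}}\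 \frac1{m(R_s)}\int_{R_s}|f(x\,y^{-1})|\,dy\ \in[0,\infty],\qquad x\in G .$$ Then for every $1<p<\infty$: (a) $M$ is a bounded map of $L^p(G)$ to itself: if $f=g$ almost everywhere then $M(f)=M(g)$, and there is a finite constant $A$, depending only on $p$ and $G$ (with its dilations and decomposition into blocks), such that for every $f\in L^p(G)$ the function $M(f)$ is measurable, belongs to $L^p(G)$, and satisfies $\|M(f)\|_{L^p(G)}\le A\,\|f\|_{L^p(G)}$. (b) There is a finite constant $A_p$, depending only on $p$ and $G$ (with its dilations and decomposition into blocks), such that for every sequence $(f_j)_{j\in\mathbb N}$ of measurable scalar-valued functions on $G$ $$\Big\|\Big(\sum_j M(f_j)^2\Big)^{1/2}\Big\|_{L^p(G)}\ \le\ A_p\,\Big\|\Big(\sum_j|f_j|^2\Big)^{1/2}\Big\|_{L^p(G)} ,$$ where both sides are allowed to be $+\infty$. -/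

import Mathlib

open MeasureTheory
open scoped ENNReal NNReal

/-- The space `ℝ^N = ℝ^{a_1} ⊕ ⋯ ⊕ ℝ^{a_n}`; a point is `x = (x_1, …, x_n)` with
`x_k ∈ ℝ^{a_k}`, and each block carries its Euclidean norm. The topology, smooth structure and
Lebesgue measure (`volume`) are the usual ones of `ℝ^N`. -/
abbrev BlockSpace {n : ℕ} (a : Fin n → ℕ) : Type :=
  (k : Fin n) → EuclideanSpace ℝ (Fin (a k))

/-- The dilation `δ_r (x_1, …, x_n) = (r^{d_1} x_1, …, r^{d_n} x_n)`. -/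
def blockDilation {n : ℕ} {a : Fin n → ℕ} (d : Fin n → ℕ) (r : ℝ) (x : BlockSpace a) :
    BlockSpace a :=
  fun k => r ^ d k • x k

/-- A homogeneous (Lie) group on `ℝ^N = ℝ^{a_1} ⊕ ⋯ ⊕ ℝ^{a_n}`: a smooth group law, written
multiplicatively, for which the dilations `δ_r`, `r > 0`, are automorphisms. When all exponents
are positive the law is automatically polynomial and nilpotent, with neutral element `0`. -/
structure HomogeneousGroup {n : ℕ} (a d : Fin n → ℕ) extends Group (BlockSpace a) where
  contDiff_mul : ContDiff ℝ ((⊤ : ℕ∞) : WithTop ℕ∞)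
    (fun z : BlockSpace a × BlockSpace a => z.1 * z.2)
  contDiff_inv : ContDiff ℝ ((⊤ : ℕ∞) : WithTop ℕ∞) (fun z : BlockSpace a => z⁻¹)
  dilation_mul : ∀ r : ℝ, 0 < r → ∀ x y : BlockSpace a,
    blockDilation d r (x * y) = blockDilation d r x * blockDilation d r y

/-- The rectangle `R_s = {x : |x_k| ≤ s_k^{d_k} for all k}`. -/
def blockRectangle {n : ℕ} (a d : Fin n → ℕ) (s : Fin n → ℝ) : Set (BlockSpace a) :=
  {x | ∀ k, ‖x k‖ ≤ s k ^ d k}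

/-- The size `s = (s_1, …, s_n)` is acceptable: `0 < s_1 ≤ s_2 ≤ ⋯ ≤ s_n`. -/
def IsAcceptable {n : ℕ} (s : Fin n → ℝ) : Prop :=
  (∀ k, 0 < s k) ∧ Monotone s

/-- The maximal function
`M f (x) = sup_s m(R_s)⁻¹ ∫_{R_s} |f (x y⁻¹)| dy`, the supremum being over all acceptable `s`;
it takes values in `[0, ∞]`. -/
noncomputable def HomogeneousGroup.maximalFunction {n : ℕ} {a d : Fin n → ℕ}
    (G : HomogeneousGroup a d) {𝕜 : Type*} [RCLike 𝕜] (f : BlockSpace a → 𝕜)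
    (x : BlockSpace a) : ℝ≥0∞ :=
  letI : Group (BlockSpace a) := G.toGroup
  ⨆ (s : Fin n → ℝ) (_ : IsAcceptable s),
    (volume (blockRectangle a d s))⁻¹ * ∫⁻ y in blockRectangle a d s, ‖f (x * y⁻¹)‖ₑ

/-! Conjugating derivatives by `δ_r` and letting `r → 0` compares them with derivatives at the
origin. This shows that Lebesgue measure is invariant under both translations and inversion, and
that the `k`-th block of a product depends only on blocks up to the `k`-th. By compactness,
rectangles with monotone exponents are therefore closed under products and inverses, up to a fixed
power `2 ^ c` of dilation. This is where acceptability enters.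

It suffices to treat dyadic sizes `2 ^ e` with `e` monotone. The many-parameter family is reduced to
one-parameter families by factoring averages. If `e` is constant equal to `t` beyond block `k`, the
average over `R_e` is dominated by an average over the flattened rectangle `min(e, e_k)` composed
with an average over the two-step rectangle `(m, …, m, t, …, t)`, where `m` is a lower bound for `e`
(`translateAverage_le_familyMaximal_comp`). Iteration bounds the maximal operator by a composition
of finitely many operators, each attached to a nested sequence of rectangles. All constants are
independent of `m`, so `m → -∞` by monotone convergence.

For a nested engulfing sequence, Vitali's lemma gives a weighted weak type inequality of
Fefferman–Stein type, hence weighted strong bounds (`Engulfing.strong_type`). The `L^p(ℓ²)` bound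
follows by summation for `p = 2`, by duality for `p > 2`, and by a pointwise factorization with
Hölder for `p < 2`. Unlike scalar bounds alone, `L^p(ℓ²)` bounds compose, so (b) survives the
iteration; (a) is the case of a single function. -/

/-! ### Averages over translated sets and their compositions. -/

section Averages

set_option linter.unusedSectionVars false

variable {H : Type*} [Group H] [MeasurableSpace H]

/-- The average of `f` over the translated set `x B⁻¹`. -/
noncomputable def translateAverage (μ : Measure H) (B : Set H) (f : H → ℝ≥0∞) (x : H) : ℝ≥0∞ :=
  (μ B)⁻¹ * ∫⁻ y in B, f (x * y⁻¹) ∂μ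

/-- The maximal function attached to a family of sets. -/
noncomputable def familyMaximal (μ : Measure H) {ι : Type*} (B : ι → Set H) (f : H → ℝ≥0∞)
    (x : H) : ℝ≥0∞ :=
  ⨆ i, translateAverage μ (B i) f x

theorem translateAverage_mono {μ : Measure H} {B : Set H} {f g : H → ℝ≥0∞} (h : ∀ x, f x ≤ g x)
    (x : H) : translateAverage μ B f x ≤ translateAverage μ B g x := by
  unfold translateAverage
  gcongr
  exact h _

theorem familyMaximal_mono {μ : Measure H} {ι : Type*} {B : ι → Set H} {f g : H → ℝ≥0∞}
    (h : ∀ x, f x ≤ g x) (x : H) : familyMaximal μ B f x ≤ familyMaximal μ B g x :=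
  iSup_mono fun _ => translateAverage_mono h x

theorem translateAverage_le_of_subset {μ : Measure H} {B B' : Set H} (h : B ⊆ B') {K : ℝ≥0∞}
    (hB : μ B ≠ 0) (hB' : μ B' ≠ ∞) (hK : μ B' ≤ K * μ B) (f : H → ℝ≥0∞) (x : H) :
    translateAverage μ B f x ≤ K * translateAverage μ B' f x := by
  unfold translateAverage
  have h0 : μ B' ≠ 0 := fun h0 => hB (measure_mono_null h h0)
  have h1 : μ B ≠ ∞ := fun h1 => hB' (measure_mono_top h h1)
  have : (μ B)⁻¹ ≤ K * (μ B')⁻¹ := by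
    rw [← div_eq_mul_inv, ENNReal.le_div_iff_mul_le (.inl h0) (.inl hB'), mul_comm,
      ← div_eq_mul_inv]
    exact ENNReal.div_le_of_le_mul hK
  rw [← mul_assoc]
  gcongr

variable [MeasurableMul₂ H] [MeasurableInv H]

theorem measurable_translateAverage {μ : Measure H} [SFinite μ] (B : Set H) {f : H → ℝ≥0∞}
    (hf : Measurable f) : Measurable (translateAverage μ B f) := by
  unfold translateAverage
  refine Measurable.const_mul ?_ _
  exact Measurable.lintegral_prod_right' (f := fun z : H × H => f (z.1 * z.2⁻¹)) (by fun_prop)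

theorem measurable_familyMaximal {μ : Measure H} [SFinite μ] {ι : Type*} [Countable ι]
    (B : ι → Set H) {f : H → ℝ≥0∞} (hf : Measurable f) : Measurable (familyMaximal μ B f) :=
  Measurable.iSup fun i => measurable_translateAverage (B i) hf

/-- Hölder's inequality for averages of geometric means. -/
theorem translateAverage_rpow_mul_rpow_le {μ : Measure H} {B : Set H} (h0 : μ B ≠ 0)
    (h1 : μ B ≠ ∞) {f g : H → ℝ≥0∞} (hf : Measurable f) (hg : Measurable g) {s t : ℝ}
    (hs : 0 ≤ s) (ht : 0 ≤ t) (hst : s + t = 1) (x : H) :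
    translateAverage μ B (fun y => f y ^ s * g y ^ t) x ≤
      translateAverage μ B f x ^ s * translateAverage μ B g x ^ t := by
  unfold translateAverage
  rw [ENNReal.mul_rpow_of_nonneg _ _ hs, ENNReal.mul_rpow_of_nonneg _ _ ht]
  have h2 : (μ B)⁻¹ = (μ B)⁻¹ ^ s * (μ B)⁻¹ ^ t := by
    rw [← ENNReal.rpow_add _ _ (by simpa using h1) (by simpa using h0), hst, ENNReal.rpow_one]
  calc _ ≤ (μ B)⁻¹ * ((∫⁻ y in B, f (x * y⁻¹) ∂μ) ^ s * (∫⁻ y in B, g (x * y⁻¹) ∂μ) ^ t) := by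
        gcongr
        exact ENNReal.lintegral_mul_norm_pow_le (by fun_prop) (by fun_prop) hs ht hst
    _ = _ := by
        conv_lhs => rw [h2]
        ring

theorem familyMaximal_rpow_mul_rpow_le {μ : Measure H} {ι : Type*} {B : ι → Set H}
    (h0 : ∀ i, μ (B i) ≠ 0) (h1 : ∀ i, μ (B i) ≠ ∞) {f g : H → ℝ≥0∞} (hf : Measurable f)
    (hg : Measurable g) {s t : ℝ} (hs : 0 ≤ s) (ht : 0 ≤ t) (hst : s + t = 1) (x : H) :
    familyMaximal μ B (fun y => f y ^ s * g y ^ t) x ≤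
      familyMaximal μ B f x ^ s * familyMaximal μ B g x ^ t := by
  refine iSup_le fun i => (translateAverage_rpow_mul_rpow_le (h0 i) (h1 i) hf hg hs ht hst x).trans ?_
  unfold familyMaximal
  gcongr <;> exact le_iSup (fun i => translateAverage μ (B i) _ x) i

theorem translateAverage_le_const {μ : Measure H} {B : Set H} {f : H → ℝ≥0∞} {c : ℝ≥0∞}
    (h : ∀ x, f x ≤ c) (x : H) : translateAverage μ B f x ≤ c := by
  unfold translateAverage
  calc _ ≤ (μ B)⁻¹ * ∫⁻ y in B, c ∂μ := by gcongr; exact h _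
    _ = c * ((μ B)⁻¹ * μ B) := by rw [setLIntegral_const]; ring
    _ ≤ c * 1 := by gcongr; exact ENNReal.inv_mul_le_one _
    _ = c := mul_one c

theorem translateAverage_add {μ : Measure H} {B : Set H} {f g : H → ℝ≥0∞} (hf : Measurable f)
    (x : H) : translateAverage μ B (fun y => f y + g y) x =
      translateAverage μ B f x + translateAverage μ B g x := by
  unfold translateAverage
  rw [lintegral_add_left (by fun_prop), mul_add]

variable {μ : Measure H} [SigmaFinite μ] [μ.IsMulLeftInvariant] [μ.IsInvInvariant]

theorem setLIntegral_translate (B : Set H) (f : H → ℝ≥0∞) (x : H) :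
    ∫⁻ y in B, f (x * y⁻¹) ∂μ = ∫⁻ z in {z | z⁻¹ * x ∈ B}, f z ∂μ := by
  have hmp := Measure.measurePreserving_div_left μ x
  have hme : MeasurableEmbedding (fun t : H => x / t) := (MeasurableEquiv.divLeft x).measurableEmbedding
  have := hmp.setLIntegral_comp_preimage_emb hme f {z | z⁻¹ * x ∈ B}
  rw [← this]
  congr 2
  · ext y; simp
  · funext y; rw [div_eq_mul_inv]

/-- If the convolution of the indicators of `B'` and `B` is bounded below on `R`, then the average
over `R` is dominated by the composition of the averages over `B'` and `B`. -/
theorem translateAverage_le_comp [μ.IsMulRightInvariant] {R B B' : Set H} {u K : ℝ≥0∞}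
    (hB : MeasurableSet B) (hB' : MeasurableSet B') (hR : MeasurableSet R)
    (hB0 : μ B ≠ 0) (hBt : μ B ≠ ∞) (hB0' : μ B' ≠ 0) (hBt' : μ B' ≠ ∞)
    (hK : μ B * μ B' ≤ K * (u * μ R))
    (h : ∀ w ∈ R, u ≤ μ {y | y ∈ B ∧ w * y⁻¹ ∈ B'}) {f : H → ℝ≥0∞} (hf : Measurable f) (x : H) :
    translateAverage μ R f x ≤ K * translateAverage μ B (translateAverage μ B' f) x := by
  -- Substituting `w = z * y` and applying Tonelli turns the iterated integral into the integral of
  -- `f (x * w⁻¹)` against the convolution `μ {y | y ∈ B ∧ w * y⁻¹ ∈ B'}`, which is at least `u` on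
  -- `R`.
  have key : u * ∫⁻ w in R, f (x * w⁻¹) ∂μ ≤
      ∫⁻ y in B, ∫⁻ z in B', f (x * y⁻¹ * z⁻¹) ∂μ ∂μ := by
    have e1 : ∀ y, ∫⁻ z in B', f (x * y⁻¹ * z⁻¹) ∂μ =
        ∫⁻ w, B'.indicator 1 (w * y⁻¹) * f (x * w⁻¹) ∂μ := by
      intro y
      rw [← lintegral_indicator hB',
        ← lintegral_mul_right_eq_self _ y⁻¹]
      congr 1
      funext w
      by_cases hw : w * y⁻¹ ∈ B' <;> simp [hw, mul_assoc]
    have m1 : Measurable (Function.uncurry fun y w : H =>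
        B.indicator (1 : H → ℝ≥0∞) y * (B'.indicator 1 (w * y⁻¹) * f (x * w⁻¹))) := by
      have hb : Measurable (B.indicator (1 : H → ℝ≥0∞)) := measurable_one.indicator hB
      have hb' : Measurable (B'.indicator (1 : H → ℝ≥0∞)) := measurable_one.indicator hB'
      unfold Function.uncurry
      fun_prop
    calc u * ∫⁻ w in R, f (x * w⁻¹) ∂μ
        = ∫⁻ w in R, u * f (x * w⁻¹) ∂μ := (lintegral_const_mul _ (by fun_prop)).symm
      _ ≤ ∫⁻ w in R, μ {y | y ∈ B ∧ w * y⁻¹ ∈ B'} * f (x * w⁻¹) ∂μ := by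
          refine setLIntegral_mono' hR fun w hw => ?_
          gcongr
          exact h w hw
      _ ≤ ∫⁻ w, μ {y | y ∈ B ∧ w * y⁻¹ ∈ B'} * f (x * w⁻¹) ∂μ := setLIntegral_le_lintegral _ _
      _ = ∫⁻ w, (∫⁻ y, B.indicator 1 y * (B'.indicator 1 (w * y⁻¹) * f (x * w⁻¹)) ∂μ) ∂μ := by
          congr 1
          funext w
          have hb : Measurable (B.indicator (1 : H → ℝ≥0∞)) := measurable_one.indicator hB
          have hb' : Measurable (B'.indicator (1 : H → ℝ≥0∞)) := measurable_one.indicator hB'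
          have hs : MeasurableSet {y | y ∈ B ∧ w * y⁻¹ ∈ B'} :=
            hB.inter ((by fun_prop : Measurable fun y : H => w * y⁻¹) hB')
          rw [← lintegral_indicator_one hs, ← lintegral_mul_const _ (measurable_one.indicator hs)]
          congr 1
          funext y
          by_cases h1 : y ∈ B <;> by_cases h2 : w * y⁻¹ ∈ B' <;> simp [h1, h2]
      _ = ∫⁻ y, (∫⁻ w, B.indicator 1 y * (B'.indicator 1 (w * y⁻¹) * f (x * w⁻¹)) ∂μ) ∂μ :=
          (lintegral_lintegral_swap m1.aemeasurable).symm
      _ = _ := by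
          rw [← lintegral_indicator hB]
          congr 1
          funext y
          by_cases h1 : y ∈ B <;> simp [h1, e1]
  have e2 : translateAverage μ B (translateAverage μ B' f) x =
      (μ B)⁻¹ * (μ B')⁻¹ * ∫⁻ y in B, ∫⁻ z in B', f (x * y⁻¹ * z⁻¹) ∂μ ∂μ := by
    unfold translateAverage
    rw [lintegral_const_mul' _ _ (by simpa using hB0')]
    ring
  rw [e2]
  unfold translateAverage
  have e3 : (μ R)⁻¹ ≤ K * ((μ B)⁻¹ * (μ B')⁻¹) * u := by
    rw [← ENNReal.mul_inv (.inl hB0) (.inl hBt), mul_assoc, mul_comm _ u, ← div_eq_mul_inv,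
      ← mul_div_assoc, ENNReal.le_div_iff_mul_le (.inl (mul_ne_zero hB0 hB0'))
        (.inl (ENNReal.mul_ne_top hBt hBt')), mul_comm, ← div_eq_mul_inv]
    exact ENNReal.div_le_of_le_mul (by rwa [mul_assoc])
  calc _ ≤ K * ((μ B)⁻¹ * (μ B')⁻¹) * u * ∫⁻ w in R, f (x * w⁻¹) ∂μ := by gcongr
    _ = K * ((μ B)⁻¹ * (μ B')⁻¹ * (u * ∫⁻ w in R, f (x * w⁻¹) ∂μ)) := by ring
    _ ≤ _ := by gcongr

end Averages

/-! ### Weighted weak and strong type estimates for nested families. -/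

section MaximalTheorem

set_option linter.unusedSectionVars false

variable {H : Type*} [Group H] [MeasurableSpace H]

/-- A nested sequence of sets `B i` of positive finite measure that are engulfed, in the sense of
Vitali's covering lemma, by sets `W i` of comparable measure. -/
structure Engulfing (μ : Measure H) (K : ℝ≥0) (B W : ℕ → Set H) : Prop where
  measurableSet : ∀ i, MeasurableSet (B i)
  monotone : Monotone B
  nonempty : ∀ i, (B i).Nonempty
  measure_ne_zero : ∀ i, μ (B i) ≠ 0
  measure_ne_top : ∀ i, μ (B i) ≠ ∞
  measure_ne_zero' : ∀ i, μ (W i) ≠ 0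
  measure_ne_top' : ∀ i, μ (W i) ≠ ∞
  measure_le : ∀ i, μ (W i) ≤ K * μ (B i)
  mul_mem : ∀ i, ∀ x ∈ B i, ∀ y ∈ B i, ∀ z ∈ B i, x⁻¹ * y * z⁻¹ ∈ W i

variable [MeasurableMul₂ H] [MeasurableInv H]
variable {μ : Measure H} [SigmaFinite μ] [μ.IsMulLeftInvariant] [μ.IsInvInvariant]

/-- Vitali selection among the sets `x B⁻¹` on which the average exceeds `t`. Each selected set pays
for the weight of its enlargement, and that weight is controlled by the maximal function of `w` at
every point of the selected set. Bounding the indices by `I` keeps the sizes bounded, as the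
selection requires. -/
theorem Engulfing.weak_type_le {K : ℝ≥0} {B W : ℕ → Set H} (h : Engulfing μ K B W)
    {f w : H → ℝ≥0∞} {t : ℝ≥0∞} (I : ℕ) :
    t * ∫⁻ x in {x | ∃ i ≤ I, t < translateAverage μ (B i) f x}, w x ∂μ ≤
      K * ∫⁻ x, f x * familyMaximal μ W w x ∂μ := by
  classical
  set E : Set H := {x | ∃ i ≤ I, t < translateAverage μ (B i) f x} with hE
  choose! r hrI hr using fun (x : H) (hx : x ∈ E) => hx
  let D : H → Set H := fun x => {z | z⁻¹ * x ∈ B (r x)}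
  have hDm : ∀ x, MeasurableSet (D x) := fun x =>
    (by fun_prop : Measurable fun z : H => z⁻¹ * x) (h.measurableSet _)
  have hDμ : ∀ x, μ (D x) = μ (B (r x)) := fun x => by
    have := setLIntegral_translate (μ := μ) (B (r x)) (fun _ => 1) x
    simpa using this.symm
  -- With sizes `2 ^ r` and factor `3 / 2 < 2`, the selected set meeting `D x` has index at least `r
  -- x`.
  obtain ⟨u, huE, hud, hu⟩ := Vitali.exists_disjoint_subfamily_covering_enlargement D E
    (fun x => (2 : ℝ) ^ r x) (3 / 2) (by norm_num) (fun _ _ => by positivity) (2 ^ I)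
    (fun x hx => pow_le_pow_right₀ (by norm_num) (hrI x hx))
    (fun x hx => by
      obtain ⟨b, hb⟩ := h.nonempty (r x)
      exact ⟨x * b⁻¹, by simpa [D] using hb⟩)
  have huc : u.Countable := by
    have := Measure.countable_meas_pos_of_disjoint_iUnion (μ := μ) (As := fun x : u => D x)
      (fun x => hDm x) (fun x y hxy => hud x.2 y.2 (by simpa [Subtype.ext_iff] using hxy))
    have h2 : {x : u | 0 < μ (D x)} = Set.univ := by
      ext x
      simp [hDμ, pos_iff_ne_zero, h.measure_ne_zero]
    rw [h2] at this
    exact Set.countable_coe_iff.mp (Set.countable_univ_iff.mp this)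
  have : Countable u := huc.to_subtype
  -- The enlargement is defined so that, seen from any `z ∈ D b`, it lies in the translate `z W⁻¹`.
  -- If `v` lies in `D x` and `D b`, then `x⁻¹ z = (v⁻¹ x)⁻¹ (v⁻¹ b) (z⁻¹ b)⁻¹`, so the engulfing
  -- property puts `x` in `V b`.
  let V : H → Set H := fun b => {x | ∀ z ∈ D b, x⁻¹ * z ∈ W (r b)}
  have hEV : E ⊆ ⋃ b : u, V b := by
    intro x hx
    obtain ⟨b, hb, ⟨v, hv1, hv2⟩, hle⟩ := hu x hx
    have hrb : r x ≤ r b := by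
      by_contra! hlt
      have h1 : (2 : ℝ) ^ (r b + 1) ≤ 2 ^ r x := pow_le_pow_right₀ (by norm_num) hlt
      have h2 : (0 : ℝ) < 2 ^ r b := by positivity
      rw [pow_succ] at h1
      linarith
    refine Set.mem_iUnion.mpr ⟨⟨b, hb⟩, fun z hz => ?_⟩
    have := h.mul_mem (r b) _ (h.monotone hrb hv1) _ hv2 _ hz
    convert this using 1
    group
  have hterm : ∀ b : u, t * ∫⁻ x in V b, w x ∂μ ≤
      K * ∫⁻ z in D b, f z * familyMaximal μ W w z ∂μ := by
    intro b
    have h1 : t ≤ (μ (B (r b)))⁻¹ * ∫⁻ z in D b, f z ∂μ := by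
      have := (hr b (huE b.2)).le
      rwa [translateAverage, setLIntegral_translate] at this
    have hinv : (μ (B (r b)))⁻¹ ≤ K * (μ (W (r b)))⁻¹ := by
      rw [← div_eq_mul_inv, ENNReal.le_div_iff_mul_le (.inl (h.measure_ne_zero' _))
        (.inl (h.measure_ne_top' _)), mul_comm, ← div_eq_mul_inv]
      exact ENNReal.div_le_of_le_mul (h.measure_le _)
    have h2 : ∀ z ∈ D b, (μ (B (r b)))⁻¹ * ∫⁻ x in V b, w x ∂μ ≤ K * familyMaximal μ W w z := by
      intro z hz
      have h3 : V b ⊆ {x | x⁻¹ * z ∈ W (r b)} := fun x hx => hx z hz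
      calc _ ≤ K * (μ (W (r b)))⁻¹ * ∫⁻ x in {x | x⁻¹ * z ∈ W (r b)}, w x ∂μ := by
            gcongr
        _ = K * translateAverage μ (W (r b)) w z := by
            rw [translateAverage, setLIntegral_translate, mul_assoc]
        _ ≤ _ := by
            gcongr
            exact le_iSup (fun i => translateAverage μ (W i) w z) (r b)
    calc _ ≤ ((μ (B (r b)))⁻¹ * ∫⁻ z in D b, f z ∂μ) * ∫⁻ x in V b, w x ∂μ := by gcongr
      _ = (∫⁻ z in D b, f z ∂μ) * ((μ (B (r b)))⁻¹ * ∫⁻ x in V b, w x ∂μ) := by ring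
      _ ≤ ∫⁻ z in D b, f z * ((μ (B (r b)))⁻¹ * ∫⁻ x in V b, w x ∂μ) ∂μ :=
          lintegral_mul_const_le _ _
      _ ≤ ∫⁻ z in D b, K * (f z * familyMaximal μ W w z) ∂μ := by
          refine setLIntegral_mono' (hDm b) fun z hz => ?_
          calc _ ≤ f z * (K * familyMaximal μ W w z) := mul_le_mul_right (h2 z hz) _
            _ = _ := by ring
      _ = _ := lintegral_const_mul' _ _ ENNReal.coe_ne_top
  calc t * ∫⁻ x in E, w x ∂μ ≤ t * ∑' b : u, ∫⁻ x in V b, w x ∂μ := by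
        gcongr
        exact (lintegral_mono_set hEV).trans (lintegral_iUnion_le _ _)
    _ = ∑' b : u, t * ∫⁻ x in V b, w x ∂μ := ENNReal.tsum_mul_left.symm
    _ ≤ ∑' b : u, K * ∫⁻ z in D b, f z * familyMaximal μ W w z ∂μ := ENNReal.tsum_le_tsum hterm
    _ = K * ∑' b : u, ∫⁻ z in D b, f z * familyMaximal μ W w z ∂μ := ENNReal.tsum_mul_left
    _ = K * ∫⁻ z in ⋃ b : u, D b, f z * familyMaximal μ W w z ∂μ := by
        rw [lintegral_iUnion (fun b : u => hDm b)
          (fun x y hxy => hud x.2 y.2 (by simpa [Subtype.ext_iff] using hxy))]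
    _ ≤ _ := by
        gcongr
        exact Measure.restrict_le_self

theorem Engulfing.weak_type {K : ℝ≥0} {B W : ℕ → Set H} (h : Engulfing μ K B W)
    {f w : H → ℝ≥0∞} {t : ℝ≥0∞} :
    t * ∫⁻ x in {x | t < familyMaximal μ B f x}, w x ∂μ ≤
      K * ∫⁻ x, f x * familyMaximal μ W w x ∂μ := by
  have e : {x | t < familyMaximal μ B f x} =
      ⋃ I : ℕ, {x | ∃ i ≤ I, t < translateAverage μ (B i) f x} := by
    ext x
    simp only [familyMaximal, lt_iSup_iff, Set.mem_ofPred_eq, Set.mem_iUnion]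
    exact ⟨fun ⟨i, hi⟩ => ⟨i, i, le_rfl, hi⟩, fun ⟨_, i, _, hi⟩ => ⟨i, hi⟩⟩
  rw [e, setLIntegral_iUnion_of_directed, ENNReal.mul_iSup]
  · exact iSup_le fun I => h.weak_type_le I
  · refine Monotone.directed_le fun I J hIJ x ⟨i, hi, hx⟩ => ⟨i, hi.trans hIJ, hx⟩

/-- The weak type estimate, with the function truncated from below at half the height. -/
theorem Engulfing.weak_type_truncated {K : ℝ≥0} {B W : ℕ → Set H} (h : Engulfing μ K B W)
    {f w : H → ℝ≥0∞} (hf : Measurable f) {t : ℝ≥0∞} :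
    t * ∫⁻ x in {x | t < familyMaximal μ B f x}, w x ∂μ ≤
      2 * K * ∫⁻ x in {x | t < 2 * f x}, f x * familyMaximal μ W w x ∂μ := by
  set S : Set H := {x | t < 2 * f x} with hS
  have hSm : MeasurableSet S := measurableSet_lt measurable_const (by fun_prop)
  have hg : Measurable (S.indicator f) := hf.indicator hSm
  -- The part of `f` that is at most `t / 2` has averages at most `t / 2`, so the large part must
  -- account for the rest.
  have hsub : {x | t < familyMaximal μ B f x} ⊆
      {x | t / 2 < familyMaximal μ B (S.indicator f) x} := by
    intro x hx
    simp only [Set.mem_ofPred_eq] at hx ⊢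
    have h1 : familyMaximal μ B f x ≤ familyMaximal μ B (S.indicator f) x + t / 2 := by
      refine iSup_le fun i => ?_
      calc translateAverage μ (B i) f x
          ≤ translateAverage μ (B i) (fun y => S.indicator f y + Sᶜ.indicator f y) x :=
            translateAverage_mono (fun y => by
              by_cases hy : y ∈ S <;> simp [hy]) x
        _ = translateAverage μ (B i) (S.indicator f) x +
            translateAverage μ (B i) (Sᶜ.indicator f) x := translateAverage_add hg x
        _ ≤ _ := by
            refine add_le_add (le_iSup (fun i => translateAverage μ (B i) (S.indicator f) x) i)
              (translateAverage_le_const (fun y => ?_) x)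
            by_cases hy : y ∈ S
            · simp [hy]
            · have : 2 * f y ≤ t := by simpa [hS] using hy
              simp only [Set.mem_compl_iff, hy, not_false_eq_true, Set.indicator_of_mem]
              rw [ENNReal.le_div_iff_mul_le (by simp) (by simp), mul_comm]
              exact this
    by_contra! h2
    have : t < t / 2 + t / 2 := hx.trans_le (h1.trans (by gcongr))
    rw [ENNReal.add_halves] at this
    exact this.false
  have e : t = 2 * (t / 2) := (ENNReal.mul_div_cancel (by simp) (by simp)).symm
  calc t * ∫⁻ x in {x | t < familyMaximal μ B f x}, w x ∂μ
      ≤ t * ∫⁻ x in {x | t / 2 < familyMaximal μ B (S.indicator f) x}, w x ∂μ := by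
        gcongr
    _ = 2 * (t / 2 * ∫⁻ x in {x | t / 2 < familyMaximal μ B (S.indicator f) x}, w x ∂μ) := by
        rw [← mul_assoc, ← e]
    _ ≤ 2 * (K * ∫⁻ x, S.indicator f x * familyMaximal μ W w x ∂μ) :=
        mul_le_mul_right h.weak_type _
    _ = _ := by
        rw [← lintegral_indicator hSm, mul_assoc]
        congr 3
        funext x
        by_cases hx : x ∈ S <;> simp [hx]

/-- The layer cake formula for a single extended nonnegative number. -/
theorem lintegral_rpow_layer {s : ℝ} (hs : 0 < s) (g : ℝ≥0∞) :
    ∫⁻ t in Set.Ioi (0 : ℝ), (if ENNReal.ofReal t < g then ENNReal.ofReal (t ^ (s - 1)) else 0) =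
      (ENNReal.ofReal s)⁻¹ * g ^ s := by
  have hfin : ∀ a : ℝ, 0 ≤ a → ∫⁻ t in Set.Ioi (0 : ℝ),
      (if ENNReal.ofReal t < ENNReal.ofReal a then ENNReal.ofReal (t ^ (s - 1)) else 0) =
      (ENNReal.ofReal s)⁻¹ * ENNReal.ofReal a ^ s := by
    intro a ha
    have h1 : ∀ t ∈ Set.Ioi (0 : ℝ),
        (if ENNReal.ofReal t < ENNReal.ofReal a then ENNReal.ofReal (t ^ (s - 1)) else 0) =
        (Set.Iio a).indicator (fun t => ENNReal.ofReal (t ^ (s - 1))) t := by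
      intro t ht
      have : ENNReal.ofReal t < ENNReal.ofReal a ↔ t < a :=
        ENNReal.ofReal_lt_ofReal_iff_of_nonneg ht.le
      simp [Set.indicator_apply, this]
    rw [setLIntegral_congr_fun measurableSet_Ioi h1, lintegral_indicator measurableSet_Iio,
      Measure.restrict_restrict measurableSet_Iio, Set.inter_comm, Set.Ioi_inter_Iio,
      ← ofReal_integral_eq_lintegral_ofReal]
    · rw [← integral_Ioc_eq_integral_Ioo, ← intervalIntegral.integral_of_le ha,
        integral_rpow (.inl (by linarith)), ENNReal.ofReal_rpow_of_nonneg ha hs.le,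
        ← ENNReal.ofReal_inv_of_pos hs, ← ENNReal.ofReal_mul (by positivity)]
      congr 1
      rw [sub_add_cancel, Real.zero_rpow hs.ne']
      ring
    · have := (intervalIntegral.intervalIntegrable_rpow' (a := 0) (b := a)
        (r := s - 1) (by linarith))
      rw [intervalIntegrable_iff_integrableOn_Ioc_of_le ha] at this
      exact this.mono_set Set.Ioo_subset_Ioc_self
    · refine (ae_restrict_iff' measurableSet_Ioo).mpr (.of_forall fun t ht => ?_)
      exact Real.rpow_nonneg ht.1.le _
  by_cases hg : g = ∞
  · subst hg
    have h0 : (ENNReal.ofReal s)⁻¹ ≠ 0 := by simp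
    rw [ENNReal.top_rpow_of_pos hs, ENNReal.mul_top h0]
    have hle : ∀ n : ℕ, (ENNReal.ofReal s)⁻¹ * (n : ℝ≥0∞) ^ s ≤ ∫⁻ t in Set.Ioi (0 : ℝ),
        (if ENNReal.ofReal t < ∞ then ENNReal.ofReal (t ^ (s - 1)) else 0) := by
      intro n
      have := hfin n n.cast_nonneg
      rw [ENNReal.ofReal_natCast] at this
      rw [← this]
      refine lintegral_mono fun t => ?_
      simp only [ENNReal.ofReal_lt_top, if_true]
      split_ifs <;> simp
    have hlim : Filter.Tendsto (fun n : ℕ => (ENNReal.ofReal s)⁻¹ * (n : ℝ≥0∞) ^ s) Filter.atTop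
        (nhds ((ENNReal.ofReal s)⁻¹ * ∞ ^ s)) :=
      ENNReal.Tendsto.const_mul
        ((ENNReal.continuous_rpow_const.tendsto _).comp ENNReal.tendsto_nat_nhds_top)
        (.inl (by simp [hs]))
    rw [ENNReal.top_rpow_of_pos hs, ENNReal.mul_top h0] at hlim
    exact top_le_iff.mp (le_of_tendsto' hlim hle)
  · have := hfin g.toReal ENNReal.toReal_nonneg
    rwa [ENNReal.ofReal_toReal hg] at this

/-- The weighted strong type estimate. -/
theorem Engulfing.strong_type {K : ℝ≥0} {B W : ℕ → Set H} (h : Engulfing μ K B W) {q : ℝ}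
    (hq : 1 < q) {f w : H → ℝ≥0∞} (hf : Measurable f) (hw : Measurable w) :
    ∫⁻ x, familyMaximal μ B f x ^ q * w x ∂μ ≤
      ENNReal.ofReal (2 ^ q * q / (q - 1)) * K *
        ∫⁻ x, f x ^ q * familyMaximal μ W w x ∂μ := by
  set N := familyMaximal μ W w with hN
  have hNm : Measurable N := measurable_familyMaximal W hw
  have hMm : Measurable (familyMaximal μ B f) := measurable_familyMaximal B hf
  have hq0 : ENNReal.ofReal q ≠ 0 := by simp; linarith
  -- Layer cake and Tonelli. It is used with exponent `q` for the maximal function, and with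
  -- exponent `q - 1` for `2 f` and weight `f N`; the truncated weak estimate compares the two
  -- integrands at each height.
  have swap : ∀ (s : ℝ) (g v : H → ℝ≥0∞), 0 < s → Measurable g → Measurable v →
      (ENNReal.ofReal s)⁻¹ * ∫⁻ x, g x ^ s * v x ∂μ = ∫⁻ t in Set.Ioi (0 : ℝ),
        ENNReal.ofReal (t ^ (s - 1)) * ∫⁻ x in {x | ENNReal.ofReal t < g x}, v x ∂μ := by
    intro s g v hs hg hv
    have hm : Measurable (Function.uncurry fun (x : H) (t : ℝ) =>
        (if ENNReal.ofReal t < g x then ENNReal.ofReal (t ^ (s - 1)) else 0) * v x) := by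
      unfold Function.uncurry
      refine Measurable.mul (Measurable.ite (measurableSet_lt (by fun_prop) (by fun_prop)) ?_
        measurable_const) (by fun_prop)
      fun_prop
    calc _ = ∫⁻ x, ((ENNReal.ofReal s)⁻¹ * g x ^ s) * v x ∂μ := by
          rw [← lintegral_const_mul _ (by fun_prop)]
          simp_rw [mul_assoc]
      _ = ∫⁻ x, (∫⁻ t in Set.Ioi (0 : ℝ),
          (if ENNReal.ofReal t < g x then ENNReal.ofReal (t ^ (s - 1)) else 0) * v x) ∂μ := by
          congr 1
          funext x
          rw [← lintegral_rpow_layer hs, lintegral_mul_const]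
          exact Measurable.ite (measurableSet_lt (by fun_prop) (by fun_prop)) (by fun_prop)
            measurable_const
      _ = ∫⁻ t in Set.Ioi (0 : ℝ), ∫⁻ x,
          (if ENNReal.ofReal t < g x then ENNReal.ofReal (t ^ (s - 1)) else 0) * v x ∂μ :=
          lintegral_lintegral_swap hm.aemeasurable
      _ = _ := by
          congr 1
          funext t
          have hSm : MeasurableSet {x | ENNReal.ofReal t < g x} :=
            measurableSet_lt measurable_const hg
          rw [← lintegral_indicator hSm, ← lintegral_const_mul' _ _ ENNReal.ofReal_ne_top]
          congr 1
          funext x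
          by_cases hx : ENNReal.ofReal t < g x <;> simp [hx]
  have h1 := swap q _ w (by linarith) hMm hw
  have h2 := swap (q - 1) (fun x => 2 * f x) (fun x => f x * N x) (by linarith) (by fun_prop)
    (by fun_prop)
  have h3 : (ENNReal.ofReal q)⁻¹ * ∫⁻ x, familyMaximal μ B f x ^ q * w x ∂μ ≤
      2 * K * ((ENNReal.ofReal (q - 1))⁻¹ * ∫⁻ x, (2 * f x) ^ (q - 1) * (f x * N x) ∂μ) := by
    rw [h1, h2, ← lintegral_const_mul' _ _ (by finiteness)]
    refine setLIntegral_mono' measurableSet_Ioi fun t ht => ?_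
    have ht : 0 < t := ht
    have e : ENNReal.ofReal (t ^ (q - 1)) = ENNReal.ofReal (t ^ (q - 1 - 1)) * ENNReal.ofReal t := by
      rw [← ENNReal.ofReal_mul (by positivity), Real.rpow_sub_one ht.ne' (q - 1)]
      congr 1
      field_simp
    rw [e, mul_assoc]
    calc _ ≤ ENNReal.ofReal (t ^ (q - 1 - 1)) * (2 * K * ∫⁻ x in {x | ENNReal.ofReal t < 2 * f x},
          f x * N x ∂μ) :=
          mul_le_mul_right (h.weak_type_truncated hf) _
      _ = _ := by ring
  have e4 : ∫⁻ x, (2 * f x) ^ (q - 1) * (f x * N x) ∂μ =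
      2 ^ (q - 1) * ∫⁻ x, f x ^ q * N x ∂μ := by
    rw [← lintegral_const_mul _ (by fun_prop)]
    congr 1
    funext x
    rw [ENNReal.mul_rpow_of_nonneg _ _ (by linarith)]
    have : f x ^ q = f x ^ (q - 1) * f x := by
      conv_rhs => rw [← ENNReal.rpow_one (f x), ← ENNReal.rpow_mul, one_mul]
      rw [← ENNReal.rpow_add_of_nonneg _ _ (by linarith) (by linarith)]
      ring_nf
    rw [this]
    ring
  rw [e4] at h3
  have e5 : ENNReal.ofReal (2 ^ q * q / (q - 1)) =
      ENNReal.ofReal q * (2 * ((ENNReal.ofReal (q - 1))⁻¹ * 2 ^ (q - 1))) := by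
    have h20 : (2 : ℝ≥0∞) = ENNReal.ofReal 2 := by simp
    rw [← ENNReal.ofReal_inv_of_pos (by linarith), h20,
      ENNReal.ofReal_rpow_of_pos (by norm_num), ← ENNReal.ofReal_mul (by
        have : 0 < q - 1 := by linarith
        positivity),
      ← ENNReal.ofReal_mul (by norm_num), ← ENNReal.ofReal_mul (by linarith)]
    congr 1
    rw [Real.rpow_sub_one (by norm_num) q]
    ring
  calc _ = ENNReal.ofReal q *
        ((ENNReal.ofReal q)⁻¹ * ∫⁻ x, familyMaximal μ B f x ^ q * w x ∂μ) := by
        rw [← mul_assoc, ENNReal.mul_inv_cancel hq0 ENNReal.ofReal_ne_top, one_mul]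
    _ ≤ _ := mul_le_mul_right h3 _
    _ = _ := by rw [e5]; ring

/-- The unweighted strong type estimate. -/
theorem Engulfing.lintegral_rpow_le {K : ℝ≥0} {B W : ℕ → Set H} (h : Engulfing μ K B W) {q : ℝ}
    (hq : 1 < q) {f : H → ℝ≥0∞} (hf : Measurable f) :
    ∫⁻ x, familyMaximal μ B f x ^ q ∂μ ≤
      ENNReal.ofReal (2 ^ q * q / (q - 1)) * K * ∫⁻ x, f x ^ q ∂μ := by
  have := h.strong_type hq hf (measurable_const (a := (1 : ℝ≥0∞)))
  simp only [mul_one] at this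
  refine this.trans ?_
  gcongr
  exact mul_le_of_le_one_right' (iSup_le fun i => translateAverage_le_const (fun _ => le_rfl) _)

end MaximalTheorem

/-! ### Vector-valued inequalities for nested families. -/

section SquareFunction

set_option linter.unusedSectionVars false

variable {H : Type*} [Group H] [MeasurableSpace H]

/-- The operator `T` is bounded on `L^p(ℓ²)`, in the form of an inequality between `p`-th powers
of the norms. -/
def SquareBound {α : Type*} [MeasurableSpace α] (μ : Measure α) (p : ℝ) (C : ℝ≥0)
    (T : (α → ℝ≥0∞) → α → ℝ≥0∞) : Prop :=
  ∀ f : ℕ → α → ℝ≥0∞, (∀ j, Measurable (f j)) →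
    ∫⁻ x, (∑' j, T (f j) x ^ 2) ^ (p / 2) ∂μ ≤ C * ∫⁻ x, (∑' j, f j x ^ 2) ^ (p / 2) ∂μ

/-- Absorption of a power of `x` into the left side; finiteness of `x` is what permits the division.
-/
theorem ENNReal.le_rpow_of_le_mul_rpow {x a : ℝ≥0∞} (hx : x ≠ ∞) {q : ℝ} (hq : 1 < q)
    (h : x ≤ a * x ^ (1 - 1 / q)) : x ≤ a ^ q := by
  by_cases h0 : x = 0
  · simp [h0]
  have hq0 : 0 < q := by linarith
  have h1 : x ^ (1 / q) * x ^ (1 - 1 / q) ≤ a * x ^ (1 - 1 / q) := by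
    rw [← ENNReal.rpow_add _ _ h0 hx, add_sub_cancel, ENNReal.rpow_one]
    exact h
  have h2 : x ^ (1 / q) ≤ a := by
    rwa [ENNReal.mul_le_mul_iff_left] at h1
    · exact (ENNReal.rpow_pos (pos_iff_ne_zero.mpr h0) hx).ne'
    · exact ENNReal.rpow_ne_top_of_nonneg' (pos_iff_ne_zero.mpr h0) hx
  calc x = (x ^ (1 / q)) ^ q := by
        rw [← ENNReal.rpow_mul, one_div_mul_cancel hq0.ne', ENNReal.rpow_one]
    _ ≤ a ^ q := by gcongr

/-- An upper bound for the integral of a power follows from the bounds for all smaller functions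
whose power has finite integral. -/
theorem lintegral_rpow_le_of_forall_le {α : Type*} [MeasurableSpace α] {μ : Measure α}
    [SigmaFinite μ] {F : α → ℝ≥0∞} (hF : Measurable F) {q : ℝ} (hq : 0 < q) {C : ℝ≥0∞}
    (h : ∀ v : α → ℝ≥0∞, Measurable v → (∀ x, v x ≤ F x) → ∫⁻ x, v x ^ q ∂μ ≠ ∞ →
      ∫⁻ x, v x ^ q ∂μ ≤ C) : ∫⁻ x, F x ^ q ∂μ ≤ C := by
  -- Truncation in height and support makes the power integrable, and the truncations increase to
  -- `F`.
  let v : ℕ → α → ℝ≥0∞ := fun n => (spanningSets μ n).indicator fun x => min (F x) n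
  have hvm : ∀ n, Measurable (v n) := fun n =>
    (hF.min measurable_const).indicator (measurableSet_spanningSets μ n)
  have hvF : ∀ n x, v n x ≤ F x := fun n x =>
    (Set.indicator_le_self _ _ _).trans (min_le_left _ _)
  have hvmono : Monotone v := by
    intro m n hmn x
    refine Set.indicator_le_indicator_of_subset (monotone_spanningSets μ hmn) (by simp) x |>.trans
      (Set.indicator_le_indicator ?_)
    gcongr
  have hsup : ∀ x, F x = ⨆ n, v n x := by
    intro x
    refine le_antisymm ?_ (iSup_le fun n => hvF n x)
    refine le_of_forall_lt fun c hc => ?_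
    obtain ⟨N, hN⟩ := ENNReal.exists_nat_gt hc.ne_top
    obtain ⟨M, hM⟩ : ∃ M, x ∈ spanningSets μ M := by
      have := Set.mem_univ x
      rwa [← iUnion_spanningSets μ, Set.mem_iUnion] at this
    refine lt_iSup_iff.mpr ⟨max M N, ?_⟩
    have hx : x ∈ spanningSets μ (max M N) := monotone_spanningSets μ (le_max_left _ _) hM
    simp only [v, Set.indicator_of_mem hx]
    refine lt_min hc (hN.trans_le ?_)
    exact_mod_cast le_max_right M N
  have hfin : ∀ n, ∫⁻ x, v n x ^ q ∂μ ≠ ∞ := by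
    intro n
    have : ∫⁻ x, v n x ^ q ∂μ ≤ (n : ℝ≥0∞) ^ q * μ (spanningSets μ n) := by
      rw [← lintegral_indicator_const (measurableSet_spanningSets μ n)]
      refine lintegral_mono fun x => ?_
      by_cases hx : x ∈ spanningSets μ n
      · simp only [v, Set.indicator_of_mem hx]
        gcongr
        exact min_le_right _ _
      · simp [v, hx, hq]
    refine (this.trans_lt ?_).ne
    exact ENNReal.mul_lt_top (by simp [ENNReal.rpow_lt_top_iff_of_pos hq])
      (measure_spanningSets_lt_top μ n)
  have e : ∀ x, F x ^ q = ⨆ n, v n x ^ q := by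
    intro x
    rw [hsup x]
    exact (ENNReal.orderIsoRpow q hq).map_iSup _
  simp_rw [e]
  rw [lintegral_iSup (fun n => (hvm n).pow_const q)
    (fun m n hmn x => ENNReal.rpow_le_rpow (hvmono hmn x) hq.le)]
  exact iSup_le fun n => h _ (hvm n) (hvF n) (hfin n)

variable [MeasurableMul₂ H] [MeasurableInv H]
variable {μ : Measure H} [SigmaFinite μ] [μ.IsMulLeftInvariant] [μ.IsInvInvariant]

/-- At `p = 2` the sum and the integral commute, so the scalar bound is summed; `8` is `2 ^ q * q /
(q - 1)` at `q = 2`. -/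
theorem Engulfing.squareBound_two {K : ℝ≥0} {B W : ℕ → Set H} (h : Engulfing μ K B W) :
    SquareBound μ 2 (8 * K) (familyMaximal μ B) := by
  intro f hf
  have hm : ∀ j, Measurable (familyMaximal μ B (f j)) := fun j => measurable_familyMaximal B (hf j)
  have h1 : ∀ j, ∫⁻ x, familyMaximal μ B (f j) x ^ 2 ∂μ ≤
      (8 * K : ℝ≥0) * ∫⁻ x, f j x ^ 2 ∂μ := by
    intro j
    have := h.lintegral_rpow_le one_lt_two (hf j)
    simp only [ENNReal.rpow_two] at this
    convert this using 3
    push_cast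
    congr 1
    norm_num
  norm_num
  rw [lintegral_tsum fun j => by fun_prop, lintegral_tsum fun j => by fun_prop,
    ← ENNReal.tsum_mul_left]
  refine ENNReal.tsum_le_tsum fun j => ?_
  simpa using h1 j

/-- Duality: the square function is tested against a weight in the dual of `L^{p/2}`. The weighted
`L²` inequality moves the maximal operator onto the weight, where the scalar bound for the family
`W` applies; hence the second engulfing hypothesis. -/
theorem Engulfing.squareBound_of_two_lt {p : ℝ} (hp : 2 < p) (K : ℝ≥0) :
    ∃ C : ℝ≥0, ∀ B W W' : ℕ → Set H, Engulfing μ K B W → Engulfing μ K W W' →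
      SquareBound μ p C (familyMaximal μ B) := by
  set q := p / 2 with hq
  have hq1 : 1 < q := by rw [hq]; linarith
  have hq0 : 0 < q := by linarith
  have hq10 : 0 < q - 1 := by linarith
  set q' := q / (q - 1) with hq'
  have hq'1 : 1 < q' := by rw [hq', one_lt_div hq10]; linarith
  have hq'0 : 0 < q' := by linarith
  have hqq' : 1 / q + 1 / q' = 1 := by rw [hq']; field_simp; ring
  set C₂ : ℝ≥0 := Real.toNNReal (2 ^ q' * q' / (q' - 1)) * K with hC₂
  refine ⟨(8 * K * C₂ ^ (1 / q')) ^ q, fun B W W' hB hW f hf => ?_⟩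
  have hm : ∀ j, Measurable (familyMaximal μ B (f j)) := fun j => measurable_familyMaximal B (hf j)
  refine lintegral_rpow_le_of_forall_le (by fun_prop) hq0 fun v hv hvF hfin => ?_
  -- The extremal dual weight: `v w = v ^ q` and `w ^ q' = v ^ q`, so the estimate closes on `∫ v ^
  -- q` itself.
  set w : H → ℝ≥0∞ := fun x => v x ^ (q - 1) with hw
  have hwm : Measurable w := by fun_prop
  have hNm : Measurable (familyMaximal μ W w) := measurable_familyMaximal W hwm
  have h1 : ∀ j, ∫⁻ x, familyMaximal μ B (f j) x ^ 2 * w x ∂μ ≤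
      (8 * K : ℝ≥0) * ∫⁻ x, f j x ^ 2 * familyMaximal μ W w x ∂μ := by
    intro j
    have := hB.strong_type one_lt_two (hf j) hwm
    simp only [ENNReal.rpow_two] at this
    convert this using 3
    push_cast
    congr 1
    norm_num
  have h2 : ∫⁻ x, v x ^ q ∂μ ≤
      (8 * K : ℝ≥0) * ∫⁻ x, (∑' j, f j x ^ 2) * familyMaximal μ W w x ∂μ := by
    calc ∫⁻ x, v x ^ q ∂μ = ∫⁻ x, v x * w x ∂μ := by
          congr 1
          funext x
          simp only [hw]
          conv_rhs => rw [← ENNReal.rpow_one (v x), ← ENNReal.rpow_mul, one_mul]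
          rw [← ENNReal.rpow_add_of_nonneg _ _ (by norm_num) hq10.le]
          ring_nf
      _ ≤ ∫⁻ x, (∑' j, familyMaximal μ B (f j) x ^ 2) * w x ∂μ := by
          gcongr with x
          exact hvF x
      _ = ∑' j, ∫⁻ x, familyMaximal μ B (f j) x ^ 2 * w x ∂μ := by
          simp_rw [← ENNReal.tsum_mul_right]
          exact lintegral_tsum fun j => by fun_prop
      _ ≤ ∑' j, (8 * K : ℝ≥0) * ∫⁻ x, f j x ^ 2 * familyMaximal μ W w x ∂μ :=
          ENNReal.tsum_le_tsum h1
      _ = _ := by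
          rw [ENNReal.tsum_mul_left]
          simp_rw [← ENNReal.tsum_mul_right]
          rw [lintegral_tsum fun j => by fun_prop]
  have h3 := ENNReal.lintegral_mul_norm_pow_le (μ := μ)
    (f := fun x => (∑' j, f j x ^ 2) ^ q) (g := fun x => familyMaximal μ W w x ^ q')
    (by fun_prop) (by fun_prop) (p := 1 / q) (q := 1 / q') (by positivity) (by positivity) hqq'
  simp_rw [← ENNReal.rpow_mul, mul_one_div_cancel hq0.ne', mul_one_div_cancel hq'0.ne',
    ENNReal.rpow_one] at h3
  have h4 := hW.lintegral_rpow_le hq'1 hwm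
  have e4 : ∫⁻ x, w x ^ q' ∂μ = ∫⁻ x, v x ^ q ∂μ := by
    congr 1
    funext x
    simp only [hw]
    rw [← ENNReal.rpow_mul, hq']
    congr 1
    field_simp
  have e5 : ENNReal.ofReal (2 ^ q' * q' / (q' - 1)) * K = C₂ := by
    rw [hC₂]; push_cast; rfl
  rw [e4, e5] at h4
  have h5 : ∫⁻ x, v x ^ q ∂μ ≤ ((8 * K : ℝ≥0) * C₂ ^ (1 / q') *
      (∫⁻ x, (∑' j, f j x ^ 2) ^ q ∂μ) ^ (1 / q)) * (∫⁻ x, v x ^ q ∂μ) ^ (1 - 1 / q) := by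
    have : 1 - 1 / q = 1 / q' := by linarith
    rw [this]
    calc _ ≤ _ := h2
      _ ≤ (8 * K : ℝ≥0) * ((∫⁻ x, (∑' j, f j x ^ 2) ^ q ∂μ) ^ (1 / q) *
          (C₂ * ∫⁻ x, v x ^ q ∂μ) ^ (1 / q')) := by
          gcongr
          exact h3.trans (by gcongr)
      _ = _ := by
          rw [ENNReal.mul_rpow_of_nonneg _ _ (by positivity)]
          ring
  refine (ENNReal.le_rpow_of_le_mul_rpow hfin hq1 h5).trans_eq ?_
  rw [ENNReal.mul_rpow_of_nonneg _ _ hq0.le, ← ENNReal.rpow_mul, one_div_mul_cancel hq0.ne',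
    ENNReal.rpow_one, ENNReal.coe_rpow_of_nonneg _ hq0.le, ENNReal.coe_mul (8 * K),
    ENNReal.coe_rpow_of_nonneg _ (by positivity)]

/-- With `S = ∑ f_j²`, one has `f_j ≤ g_j^{1-θ} h^θ`, where `∑ g_j^{p₁}` and `h^{p₂}` are both at
most `S^{p/2}`. Hölder for averages passes this factorization to the maximal functions, and only
scalar bounds at `p₁, p₂ > 1` remain. Since `2 (1 - θ) = p₁`, squaring turns the `ℓ²` sum into `∑ (M
g_j)^{p₁}`, and a last Hölder with exponents `p / 2` and `1 - p / 2` separates the factors. -/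
theorem Engulfing.squareBound_of_lt_two {p : ℝ} (hp1 : 1 < p) (hp : p < 2) (K : ℝ≥0) :
    ∃ C : ℝ≥0, ∀ B W : ℕ → Set H, Engulfing μ K B W →
      SquareBound μ p C (familyMaximal μ B) := by
  have hp0 : 0 < p := by linarith
  have h2p : 0 < 2 - p := by linarith
  set θ := 1 / (2 * p) with hθ
  have hθ0 : 0 < θ := by positivity
  have hθ1 : θ < 1 / 2 := by
    rw [hθ]
    exact one_div_lt_one_div_of_lt (by norm_num) (by linarith)
  set p₁ := 2 * (1 - θ) with hp₁
  have hp₁1 : 1 < p₁ := by rw [hp₁]; linarith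
  set p₂ := 1 / (2 - p) with hp₂
  have hp₂1 : 1 < p₂ := by rw [hp₂, one_lt_div h2p]; linarith
  set C₁ : ℝ≥0 := Real.toNNReal (2 ^ p₁ * p₁ / (p₁ - 1)) * K with hC₁
  set C₂ : ℝ≥0 := Real.toNNReal (2 ^ p₂ * p₂ / (p₂ - 1)) * K with hC₂
  refine ⟨C₁ ^ (p / 2) * C₂ ^ (1 - p / 2), fun B W hB f hf => ?_⟩
  set S : H → ℝ≥0∞ := fun x => ∑' j, f j x ^ 2 with hS
  have hSm : Measurable S := by fun_prop
  set h : H → ℝ≥0∞ := fun x => S x ^ (p * (2 - p) / 2) with hh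
  have hhm : Measurable h := by fun_prop
  -- The exponent `p / 2 - 1` is negative, so where `S = ∞` the formula would give `0` for finite
  -- `f_j`; the value `∞` keeps the factorization valid.
  set g : ℕ → H → ℝ≥0∞ := fun j x =>
    if S x = ∞ then ∞ else (f j x ^ 2 * S x ^ (p / 2 - 1)) ^ (1 / p₁) with hg
  have hgm : ∀ j, Measurable (g j) := fun j =>
    Measurable.ite (hSm (measurableSet_singleton ∞)) measurable_const (by fun_prop)
  have hfg : ∀ j x, f j x ≤ g j x ^ (1 - θ) * h x ^ θ := by
    intro j x
    by_cases hx : S x = ∞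
    · have e1 : 0 < p * (2 - p) / 2 := by positivity
      simp [hg, hh, hx, ENNReal.top_rpow_of_pos e1, ENNReal.top_rpow_of_pos hθ0,
        ENNReal.top_rpow_of_pos (show 0 < 1 - θ by linarith)]
    · by_cases hx0 : S x = 0
      · have : f j x = 0 := by
          have := ENNReal.tsum_eq_zero.mp hx0 j
          simpa using this
        simp [this]
      · simp only [hg, hh, hx, if_false]
        rw [← ENNReal.rpow_mul, ← ENNReal.rpow_mul, ENNReal.mul_rpow_of_nonneg _ _ (by
          have : 0 < 1 - θ := by linarith
          positivity), ← ENNReal.rpow_mul, mul_assoc, ← ENNReal.rpow_add _ _ hx0 hx,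
          ← ENNReal.rpow_natCast, ← ENNReal.rpow_mul]
        have e1 : 1 / p₁ * (1 - θ) = 1 / 2 := by
          have : 1 - θ ≠ 0 := by linarith
          rw [hp₁]; field_simp
        have e2 : (p / 2 - 1) * (1 / p₁ * (1 - θ)) + p * (2 - p) / 2 * θ = 0 := by
          rw [e1, hθ]; field_simp; ring
        rw [e2, e1]
        simp
  have hgS : ∀ x, ∑' j, g j x ^ p₁ ≤ S x ^ (p / 2) := by
    intro x
    by_cases hx : S x = ∞
    · rw [hx, ENNReal.top_rpow_of_pos (by positivity)]
      exact le_top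
    · have e : ∀ j, g j x ^ p₁ = f j x ^ 2 * S x ^ (p / 2 - 1) := by
        intro j
        simp only [hg, hx, if_false]
        rw [← ENNReal.rpow_mul, one_div_mul_cancel (by linarith), ENNReal.rpow_one]
      simp_rw [e]
      rw [ENNReal.tsum_mul_right]
      by_cases hx0 : S x = 0
      · have : ∑' j, f j x ^ 2 = 0 := hx0
        simp [this]
      · change S x * _ ≤ _
        conv_lhs => rw [← ENNReal.rpow_one (S x), ← ENNReal.rpow_mul, one_mul]
        rw [← ENNReal.rpow_add _ _ hx0 hx]
        apply le_of_eq
        ring_nf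
  have hhS : ∀ x, h x ^ p₂ = S x ^ (p / 2) := by
    intro x
    simp only [hh]
    rw [← ENNReal.rpow_mul, hp₂]
    congr 1
    field_simp
  have hMm : ∀ j, Measurable (familyMaximal μ B (g j)) := fun j =>
    measurable_familyMaximal B (hgm j)
  have hMh : Measurable (familyMaximal μ B h) := measurable_familyMaximal B hhm
  have h1 : ∀ x, (∑' j, familyMaximal μ B (f j) x ^ 2) ^ (p / 2) ≤
      (∑' j, familyMaximal μ B (g j) x ^ p₁) ^ (p / 2) *
        (familyMaximal μ B h x ^ p₂) ^ (1 - p / 2) := by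
    intro x
    have e1 : ∀ j, familyMaximal μ B (f j) x ^ 2 ≤
        familyMaximal μ B (g j) x ^ p₁ * familyMaximal μ B h x ^ (2 * θ) := by
      intro j
      calc _ ≤ (familyMaximal μ B (g j) x ^ (1 - θ) * familyMaximal μ B h x ^ θ) ^ 2 := by
            gcongr
            exact (familyMaximal_mono (hfg j) x).trans (familyMaximal_rpow_mul_rpow_le
              hB.measure_ne_zero hB.measure_ne_top (hgm j) hhm (by linarith) hθ0.le (by ring) x)
        _ = _ := by
            rw [← ENNReal.rpow_natCast, ENNReal.mul_rpow_of_nonneg _ _ (by norm_num),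
              ← ENNReal.rpow_mul, ← ENNReal.rpow_mul, hp₁]
            norm_num [mul_comm]
    calc _ ≤ ((∑' j, familyMaximal μ B (g j) x ^ p₁) *
          familyMaximal μ B h x ^ (2 * θ)) ^ (p / 2) := by
          rw [← ENNReal.tsum_mul_right]
          gcongr with j
          exact e1 j
      _ = _ := by
          rw [ENNReal.mul_rpow_of_nonneg _ _ (by positivity), ← ENNReal.rpow_mul,
            ← ENNReal.rpow_mul]
          congr 2
          rw [hθ, hp₂]
          field_simp
  have e5 : ENNReal.ofReal (2 ^ p₁ * p₁ / (p₁ - 1)) * K = C₁ := by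
    rw [hC₁]; push_cast; rfl
  have e6 : ENNReal.ofReal (2 ^ p₂ * p₂ / (p₂ - 1)) * K = C₂ := by
    rw [hC₂]; push_cast; rfl
  have h2 : ∫⁻ x, ∑' j, familyMaximal μ B (g j) x ^ p₁ ∂μ ≤ C₁ * ∫⁻ x, S x ^ (p / 2) ∂μ := by
    rw [lintegral_tsum fun j => by fun_prop]
    calc _ ≤ ∑' j, C₁ * ∫⁻ x, g j x ^ p₁ ∂μ := ENNReal.tsum_le_tsum fun j => by
          rw [← e5]
          exact hB.lintegral_rpow_le hp₁1 (hgm j)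
      _ = C₁ * ∫⁻ x, ∑' j, g j x ^ p₁ ∂μ := by
          rw [ENNReal.tsum_mul_left, lintegral_tsum fun j => by fun_prop]
      _ ≤ _ := by
          gcongr with x
          exact hgS x
  have h3 : ∫⁻ x, familyMaximal μ B h x ^ p₂ ∂μ ≤ C₂ * ∫⁻ x, S x ^ (p / 2) ∂μ := by
    simp_rw [← hhS, ← e6]
    exact hB.lintegral_rpow_le hp₂1 hhm
  calc _ ≤ ∫⁻ x, (∑' j, familyMaximal μ B (g j) x ^ p₁) ^ (p / 2) *
        (familyMaximal μ B h x ^ p₂) ^ (1 - p / 2) ∂μ := lintegral_mono h1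
    _ ≤ (∫⁻ x, ∑' j, familyMaximal μ B (g j) x ^ p₁ ∂μ) ^ (p / 2) *
        (∫⁻ x, familyMaximal μ B h x ^ p₂ ∂μ) ^ (1 - p / 2) :=
        ENNReal.lintegral_mul_norm_pow_le (by fun_prop) (by fun_prop) (by positivity)
          (by linarith) (by ring)
    _ ≤ (C₁ * ∫⁻ x, S x ^ (p / 2) ∂μ) ^ (p / 2) *
        (C₂ * ∫⁻ x, S x ^ (p / 2) ∂μ) ^ (1 - p / 2) := by
        gcongr
        linarith
    _ = _ := by
        have e7 : (1 : ℝ) = p / 2 + (1 - p / 2) := by ring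
        have e8 : 0 ≤ 1 - p / 2 := by linarith
        rw [ENNReal.mul_rpow_of_nonneg _ _ (by positivity), ENNReal.mul_rpow_of_nonneg _ _ e8,
          ENNReal.coe_mul (C₁ ^ _), ENNReal.coe_rpow_of_nonneg _ (by positivity),
          ENNReal.coe_rpow_of_nonneg _ e8]
        conv_rhs => rw [← ENNReal.rpow_one (∫⁻ x, S x ^ (p / 2) ∂μ), e7,
          ENNReal.rpow_add_of_nonneg _ _ (by positivity) e8]
        ring_nf

/-- Vector-valued maximal inequality, uniformly over all engulfing families. -/
theorem Engulfing.exists_squareBound {p : ℝ} (hp : 1 < p) (K : ℝ≥0) :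
    ∃ C : ℝ≥0, ∀ B W W' : ℕ → Set H, Engulfing μ K B W → Engulfing μ K W W' →
      SquareBound μ p C (familyMaximal μ B) := by
  rcases lt_trichotomy p 2 with h | h | h
  · obtain ⟨C, hC⟩ := Engulfing.squareBound_of_lt_two (μ := μ) hp h K
    exact ⟨C, fun B W _ hB _ => hC B W hB⟩
  · subst h
    exact ⟨8 * K, fun B W _ hB _ => hB.squareBound_two⟩
  · exact Engulfing.squareBound_of_two_lt h K

end SquareFunction

/-! ### Invariance of Lebesgue measure and triangularity of the group law. -/

section HomogeneousStructure

open Filter Topology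

variable {n : ℕ} {a d : Fin n → ℕ}

/-- The dilation as a continuous linear map. -/
noncomputable def blockDilationCLM (a d : Fin n → ℕ) (r : ℝ) : BlockSpace a →L[ℝ] BlockSpace a :=
  ContinuousLinearMap.pi fun k => r ^ d k • ContinuousLinearMap.proj k

@[simp]
theorem blockDilationCLM_apply (r : ℝ) (x : BlockSpace a) :
    blockDilationCLM a d r x = blockDilation d r x := rfl

theorem blockDilation_inv_cancel {r : ℝ} (hr : r ≠ 0) (x : BlockSpace a) :
    blockDilation d r (blockDilation d r⁻¹ x) = x := by
  funext k
  simp [blockDilation, smul_smul, hr]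

theorem blockDilation_zero (hd : ∀ k, 0 < d k) (x : BlockSpace a) :
    blockDilation d 0 x = 0 := by
  funext k
  simp [blockDilation, (hd k).ne']

theorem continuous_blockDilation (x : BlockSpace a) :
    Continuous fun r : ℝ => blockDilation d r x := by
  unfold blockDilation
  fun_prop

theorem tendsto_blockDilation (hd : ∀ k, 0 < d k) (x : BlockSpace a) :
    Tendsto (fun r : ℝ => blockDilation d r x) (𝓝[>] 0) (𝓝 0) := by
  have := (continuous_blockDilation (d := d) x).tendsto 0
  rw [blockDilation_zero hd] at this
  exact this.mono_left nhdsWithin_le_nhds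

theorem det_blockDilationCLM_ne_zero {r : ℝ} (hr : r ≠ 0) :
    (blockDilationCLM a d r).det ≠ 0 := by
  have h : (blockDilationCLM a d r : BlockSpace a →ₗ[ℝ] BlockSpace a) ∘ₗ
      (blockDilationCLM a d r⁻¹ : BlockSpace a →ₗ[ℝ] BlockSpace a) = LinearMap.id := by
    exact LinearMap.ext fun x => blockDilation_inv_cancel hr x
  have h2 := congrArg LinearMap.det h
  rw [LinearMap.det_comp, LinearMap.det_id] at h2
  exact left_ne_zero_of_mul_eq_one h2

/-- A continuous family of linear maps that is invariant under conjugation by dilations has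
constant determinant. -/
theorem det_eq_of_conj_blockDilation {Z : Type*} [TopologicalSpace Z]
    {A : Z → BlockSpace a →L[ℝ] BlockSpace a} (hA : Continuous A) {z z₀ : Z} {c : ℝ → Z}
    (hc : Tendsto c (𝓝[>] 0) (𝓝 z₀))
    (h : ∀ r : ℝ, 0 < r → ∀ v, A (c r) (blockDilation d r v) = blockDilation d r (A z v)) :
    (A z).det = (A z₀).det := by
  have h1 : ∀ r : ℝ, 0 < r → (A (c r)).det = (A z).det := by
    intro r hr
    have h2 : (A (c r) : BlockSpace a →ₗ[ℝ] BlockSpace a) ∘ₗ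
        (blockDilationCLM a d r : BlockSpace a →ₗ[ℝ] BlockSpace a) =
        (blockDilationCLM a d r : BlockSpace a →ₗ[ℝ] BlockSpace a) ∘ₗ
        (A z : BlockSpace a →ₗ[ℝ] BlockSpace a) := by
      exact LinearMap.ext fun v => h r hr v
    have h3 := congrArg LinearMap.det h2
    rw [LinearMap.det_comp, LinearMap.det_comp, mul_comm] at h3
    exact mul_left_cancel₀ (det_blockDilationCLM_ne_zero hr.ne') h3
  have h4 : Tendsto (fun r => (A (c r)).det) (𝓝[>] 0) (𝓝 (A z₀).det) :=
    ((ContinuousLinearMap.continuous_det.comp hA).tendsto z₀).comp hc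
  have h5 : Tendsto (fun r => (A (c r)).det) (𝓝[>] 0) (𝓝 (A z).det) :=
    tendsto_const_nhds.congr' (by
      filter_upwards [self_mem_nhdsWithin] with r hr
      exact (h1 r hr).symm)
  exact tendsto_nhds_unique h5 h4

/-- A differentiable bijection with unit Jacobian preserves Lebesgue measure. -/
theorem measurePreserving_of_abs_det_eq_one {φ : BlockSpace a → BlockSpace a}
    {φ' : BlockSpace a → BlockSpace a →L[ℝ] BlockSpace a} (hφ : Function.Bijective φ)
    (h : ∀ x, HasFDerivAt φ (φ' x) x) (hdet : ∀ x, |(φ' x).det| = 1) :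
    MeasurePreserving φ volume volume := by
  have hc : Continuous φ := continuous_iff_continuousAt.mpr fun x => (h x).continuousAt
  refine ⟨hc.measurable, Measure.ext fun A hA => ?_⟩
  rw [Measure.map_apply hc.measurable hA]
  have := lintegral_image_eq_lintegral_abs_det_fderiv_mul volume MeasurableSet.univ
    (fun x _ => (h x).hasFDerivWithinAt) hφ.injective.injOn (A.indicator 1)
  simp only [Set.image_univ, hφ.surjective.range_eq, Measure.restrict_univ, hdet,
    ENNReal.ofReal_one, one_mul] at this
  rw [lintegral_indicator_one hA] at this
  rw [this, ← lintegral_indicator_one (hc.measurable hA)]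
  rfl

variable [Group (BlockSpace a)]

/-- The multiplicative structure on `BlockSpace a` is smooth and compatible with the dilations. -/
structure IsHomogeneousLaw (d : Fin n → ℕ) [Group (BlockSpace a)] : Prop where
  contDiff_mul : ContDiff ℝ ((⊤ : ℕ∞) : WithTop ℕ∞)
    (fun z : BlockSpace a × BlockSpace a => z.1 * z.2)
  contDiff_inv : ContDiff ℝ ((⊤ : ℕ∞) : WithTop ℕ∞) (fun z : BlockSpace a => z⁻¹)
  dilation_mul : ∀ r : ℝ, 0 < r → ∀ x y : BlockSpace a,
    blockDilation d r (x * y) = blockDilation d r x * blockDilation d r y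
  pos : ∀ k, 0 < d k
  mono : Monotone d

namespace IsHomogeneousLaw

variable (hG : IsHomogeneousLaw (a := a) d)
include hG

theorem dilation_one {r : ℝ} (hr : 0 < r) :
    blockDilation d r (1 : BlockSpace a) = 1 := by
  have := hG.dilation_mul r hr 1 1
  rw [mul_one] at this
  exact left_eq_mul.mp this

theorem dilation_inv {r : ℝ} (hr : 0 < r) (x : BlockSpace a) :
    blockDilation d r x⁻¹ = (blockDilation d r x)⁻¹ := by
  rw [eq_inv_iff_mul_eq_one, ← hG.dilation_mul r hr, inv_mul_cancel, hG.dilation_one hr]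

/-- The neutral element is fixed by all dilations, while `δ_r` contracts every point to `0`. -/
theorem one_eq_zero : (1 : BlockSpace a) = 0 := by
  have h : Tendsto (fun r : ℝ => blockDilation d r (1 : BlockSpace a)) (𝓝[>] 0) (𝓝 1) :=
    tendsto_const_nhds.congr' (by
      filter_upwards [self_mem_nhdsWithin] with r hr
      exact (hG.dilation_one hr).symm)
  exact tendsto_nhds_unique h (tendsto_blockDilation hG.pos 1)

theorem hasFDerivAt_mul (z : BlockSpace a × BlockSpace a) :
    HasFDerivAt (fun z : BlockSpace a × BlockSpace a => z.1 * z.2)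
      (fderiv ℝ (fun z : BlockSpace a × BlockSpace a => z.1 * z.2) z) z :=
  (hG.contDiff_mul.differentiable (by simp) z).hasFDerivAt

theorem continuous_fderiv_mul :
    Continuous (fderiv ℝ (fun z : BlockSpace a × BlockSpace a => z.1 * z.2)) :=
  hG.contDiff_mul.continuous_fderiv (by simp)

theorem fderiv_mul_dilation {r : ℝ} (hr : 0 < r) (z v : BlockSpace a × BlockSpace a) :
    fderiv ℝ (fun z : BlockSpace a × BlockSpace a => z.1 * z.2)
        (blockDilation d r z.1, blockDilation d r z.2)
        (blockDilation d r v.1, blockDilation d r v.2) =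
      blockDilation d r (fderiv ℝ (fun z : BlockSpace a × BlockSpace a => z.1 * z.2) z v) := by
  have h1 := ((blockDilationCLM a d r).hasFDerivAt (x := z.1 * z.2)).comp z (hG.hasFDerivAt_mul z)
  have h2 := (hG.hasFDerivAt_mul (blockDilation d r z.1, blockDilation d r z.2)).comp z
    (((blockDilationCLM a d r).prodMap (blockDilationCLM a d r)).hasFDerivAt (x := z))
  have h3 : (blockDilationCLM a d r) ∘ (fun z : BlockSpace a × BlockSpace a => z.1 * z.2) =
      (fun z : BlockSpace a × BlockSpace a => z.1 * z.2) ∘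
      ((blockDilationCLM a d r).prodMap (blockDilationCLM a d r)) := by
    funext z
    exact hG.dilation_mul r hr z.1 z.2
  rw [h3] at h1
  exact (congrArg (fun L : BlockSpace a × BlockSpace a →L[ℝ] BlockSpace a => L v)
    (h1.unique h2)).symm

theorem fderiv_mul_zero (v : BlockSpace a × BlockSpace a) :
    fderiv ℝ (fun z : BlockSpace a × BlockSpace a => z.1 * z.2) 0 v = v.1 + v.2 := by
  have h0 := hG.hasFDerivAt_mul 0
  have h1 := HasFDerivAt.comp (f := ContinuousLinearMap.inl ℝ (BlockSpace a) (BlockSpace a))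
    (0 : BlockSpace a) h0 ((ContinuousLinearMap.inl ℝ (BlockSpace a) (BlockSpace a)).hasFDerivAt (x := 0))
  have h2 := HasFDerivAt.comp (f := ContinuousLinearMap.inr ℝ (BlockSpace a) (BlockSpace a))
    (0 : BlockSpace a) h0 ((ContinuousLinearMap.inr ℝ (BlockSpace a) (BlockSpace a)).hasFDerivAt (x := 0))
  have e1 : (fun z : BlockSpace a × BlockSpace a => z.1 * z.2) ∘
      (ContinuousLinearMap.inl ℝ (BlockSpace a) (BlockSpace a)) = id := by
    funext x
    simp [← hG.one_eq_zero]
  have e2 : (fun z : BlockSpace a × BlockSpace a => z.1 * z.2) ∘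
      (ContinuousLinearMap.inr ℝ (BlockSpace a) (BlockSpace a)) = id := by
    funext x
    simp [← hG.one_eq_zero]
  rw [e1] at h1
  rw [e2] at h2
  have u1 := congrArg (fun L : BlockSpace a →L[ℝ] BlockSpace a => L v.1)
    (h1.unique (hasFDerivAt_id 0))
  have u2 := congrArg (fun L : BlockSpace a →L[ℝ] BlockSpace a => L v.2)
    (h2.unique (hasFDerivAt_id 0))
  simp only [ContinuousLinearMap.comp_apply, ContinuousLinearMap.inl_apply,
    ContinuousLinearMap.inr_apply, ContinuousLinearMap.id_apply] at u1 u2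
  conv_lhs => rw [show v = (v.1, 0) + (0, v.2) by simp]
  rw [map_add, u1, u2]

/-- Homogeneity allows the derivative to be computed at `δ_r z` along a rescaled vector. As `r → 0`
it becomes the derivative at the origin, which is addition and does not mix blocks. This also covers
blocks `i > k` with `d i = d k`. -/
theorem fderiv_mul_apply_eq_zero {k : Fin n} (z v : BlockSpace a × BlockSpace a)
    (h1 : ∀ i ≤ k, v.1 i = 0) (h2 : ∀ i ≤ k, v.2 i = 0) :
    fderiv ℝ (fun z : BlockSpace a × BlockSpace a => z.1 * z.2) z v k = 0 := by
  -- This is `r ^ (-d k) δ_r`. The natural subtraction truncates only at some `i ≤ k`, where the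
  -- vectors vanish; for `i > k` it is exact by monotonicity of `d`.
  let u : ℝ → BlockSpace a → BlockSpace a := fun r x i => r ^ (d i - d k) • x i
  have hu : ∀ (r : ℝ) (x : BlockSpace a), (∀ i ≤ k, x i = 0) →
      blockDilation d r x = r ^ d k • u r x := by
    intro r x hx
    funext i
    by_cases hi : i ≤ k
    · simp [blockDilation, u, hx i hi]
    · simp only [blockDilation, u, Pi.smul_apply, smul_smul, ← pow_add]
      rw [Nat.add_sub_cancel' (hG.mono (not_le.mp hi).le)]
  have huc : ∀ x : BlockSpace a, Continuous fun r : ℝ => u r x := by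
    intro x
    unfold u
    fun_prop
  have h3 : ∀ r : ℝ, 0 < r → fderiv ℝ (fun z : BlockSpace a × BlockSpace a => z.1 * z.2)
      (blockDilation d r z.1, blockDilation d r z.2) (u r v.1, u r v.2) k =
      fderiv ℝ (fun z : BlockSpace a × BlockSpace a => z.1 * z.2) z v k := by
    intro r hr
    have := congrFun (hG.fderiv_mul_dilation hr z v) k
    rw [hu r v.1 h1, hu r v.2 h2, ← Prod.smul_mk, map_smul] at this
    exact smul_right_injective _ (pow_pos hr (d k)).ne' this
  have h4 : Continuous fun r : ℝ => fderiv ℝ (fun z : BlockSpace a × BlockSpace a => z.1 * z.2)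
      (blockDilation d r z.1, blockDilation d r z.2) (u r v.1, u r v.2) k := by
    have e1 : Continuous fun r : ℝ => fderiv ℝ (fun z : BlockSpace a × BlockSpace a => z.1 * z.2)
      (blockDilation d r z.1, blockDilation d r z.2) :=
      hG.continuous_fderiv_mul.comp
        ((continuous_blockDilation z.1).prodMk (continuous_blockDilation z.2))
    exact (continuous_apply k).comp (e1.clm_apply ((huc v.1).prodMk (huc v.2)))
  have h5 := (h4.tendsto 0).mono_left (nhdsWithin_le_nhds (s := Set.Ioi 0))
  rw [blockDilation_zero hG.pos, blockDilation_zero hG.pos, ← Prod.zero_eq_mk,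
    hG.fderiv_mul_zero] at h5
  have h6 := tendsto_nhds_unique (h5.congr' (by
    filter_upwards [self_mem_nhdsWithin] with r hr
    exact h3 r hr)) tendsto_const_nhds
  rw [← h6]
  simp [u, h1 k le_rfl, h2 k le_rfl]

/-- The `k`-th block of a product depends only on the blocks of the factors up to the `k`-th. -/
theorem mul_apply_congr {k : Fin n} {x y x' y' : BlockSpace a} (hx : ∀ i ≤ k, x i = x' i)
    (hy : ∀ i ≤ k, y i = y' i) : (x * y) k = (x' * y') k := by
  -- The `k`-th block of the product has zero derivative along the segment joining the two pairs.
  let v : BlockSpace a × BlockSpace a := (x' - x, y' - y)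
  let g : ℝ → EuclideanSpace ℝ (Fin (a k)) := fun t =>
    (((x, y) + t • v).1 * ((x, y) + t • v).2) k
  have hg : ∀ t, HasDerivAt g 0 t := by
    intro t
    have h1 := hG.hasFDerivAt_mul ((x, y) + t • v)
    have h2 : HasDerivAt (fun t : ℝ => (x, y) + t • v) v t := by
      simpa using ((hasDerivAt_id t).smul_const v).const_add (x, y)
    have h3 := h1.comp_hasDerivAt t h2
    have h4 := hasDerivAt_pi.mp h3 k
    rw [hG.fderiv_mul_apply_eq_zero _ _ (fun i hi => by simp [v, hx i hi])
      (fun i hi => by simp [v, hy i hi])] at h4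
    exact h4
  have := is_const_of_deriv_eq_zero (fun t => (hg t).differentiableAt) (fun t => (hg t).deriv) 0 1
  simpa [g, v] using this

/-- Compare `x⁻¹ = x⁻¹ (x' x'⁻¹)` with `x'⁻¹ = x⁻¹ (x x'⁻¹)`: the right factors agree up to block
`k`. -/
theorem inv_apply_congr {k : Fin n} {x x' : BlockSpace a} (hx : ∀ i ≤ k, x i = x' i) :
    x⁻¹ k = x'⁻¹ k := by
  have h1 : ∀ i ≤ k, (x' * x'⁻¹) i = (x * x'⁻¹) i := fun i hi =>
    hG.mul_apply_congr (fun j hj => (hx j (hj.trans hi)).symm) fun _ _ => rfl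
  have h2 : (x⁻¹ * (x' * x'⁻¹)) k = (x⁻¹ * (x * x'⁻¹)) k :=
    hG.mul_apply_congr (fun _ _ => rfl) h1
  simpa using h2

/-- The Jacobian determinant is unchanged under dilation of the base point, so it equals its value
at the origin, where the derivative is the identity. -/
theorem measurePreserving_mul_left (x : BlockSpace a) :
    MeasurePreserving (fun y : BlockSpace a => x * y) volume volume := by
  refine measurePreserving_of_abs_det_eq_one (Group.mulLeft_bijective x)
    (φ' := fun y => (fderiv ℝ (fun z : BlockSpace a × BlockSpace a => z.1 * z.2) (x, y)).comp
      (ContinuousLinearMap.inr ℝ _ _)) (fun y => ?_) fun y => ?_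
  · refine (hG.hasFDerivAt_mul (x, y)).comp y ?_
    exact hasFDerivAt_prodMk_right x y
  · have := det_eq_of_conj_blockDilation (d := d)
      (A := fun z => (fderiv ℝ (fun z : BlockSpace a × BlockSpace a => z.1 * z.2) z).comp
        (ContinuousLinearMap.inr ℝ _ _)) (hG.continuous_fderiv_mul.clm_comp continuous_const)
      (z := (x, y)) (z₀ := 0) (c := fun r => (blockDilation d r x, blockDilation d r y))
      ((tendsto_blockDilation hG.pos x).prodMk_nhds (tendsto_blockDilation hG.pos y))
      (fun r hr v => by
        have := hG.fderiv_mul_dilation hr (x, y) (0, v)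
        simpa [← blockDilationCLM_apply] using this)
    rw [this]
    have h0 : (fderiv ℝ (fun z : BlockSpace a × BlockSpace a => z.1 * z.2) 0).comp
        (ContinuousLinearMap.inr ℝ _ _) = ContinuousLinearMap.id ℝ (BlockSpace a) := by
      ext1 v
      simp [hG.fderiv_mul_zero]
    rw [h0]
    simp [ContinuousLinearMap.det]

theorem measurePreserving_mul_right (x : BlockSpace a) :
    MeasurePreserving (fun y : BlockSpace a => y * x) volume volume := by
  refine measurePreserving_of_abs_det_eq_one (Group.mulRight_bijective x)
    (φ' := fun y => (fderiv ℝ (fun z : BlockSpace a × BlockSpace a => z.1 * z.2) (y, x)).comp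
      (ContinuousLinearMap.inl ℝ _ _)) (fun y => ?_) fun y => ?_
  · refine HasFDerivAt.comp (f := fun y => (y, x)) y (hG.hasFDerivAt_mul (y, x)) ?_
    exact hasFDerivAt_prodMk_left y x
  · have := det_eq_of_conj_blockDilation (d := d)
      (A := fun z => (fderiv ℝ (fun z : BlockSpace a × BlockSpace a => z.1 * z.2) z).comp
        (ContinuousLinearMap.inl ℝ _ _)) (hG.continuous_fderiv_mul.clm_comp continuous_const)
      (z := (y, x)) (z₀ := 0) (c := fun r => (blockDilation d r y, blockDilation d r x))
      ((tendsto_blockDilation hG.pos y).prodMk_nhds (tendsto_blockDilation hG.pos x))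
      (fun r hr v => by
        have := hG.fderiv_mul_dilation hr (y, x) (v, 0)
        simpa [← blockDilationCLM_apply] using this)
    rw [this]
    have h0 : (fderiv ℝ (fun z : BlockSpace a × BlockSpace a => z.1 * z.2) 0).comp
        (ContinuousLinearMap.inl ℝ _ _) = ContinuousLinearMap.id ℝ (BlockSpace a) := by
      ext1 v
      simp [hG.fderiv_mul_zero]
    rw [h0]
    simp [ContinuousLinearMap.det]

/-- As for translations, the Jacobian is that at the origin; inversion is an involution fixing `0`,
so this determinant squares to `1`. -/
theorem measurePreserving_inv :
    MeasurePreserving (fun y : BlockSpace a => y⁻¹) volume volume := by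
  have hD : ∀ x, HasFDerivAt (fun y : BlockSpace a => y⁻¹)
      (fderiv ℝ (fun y : BlockSpace a => y⁻¹) x) x := fun x =>
    (hG.contDiff_inv.differentiable (by simp) x).hasFDerivAt
  refine measurePreserving_of_abs_det_eq_one inv_involutive.bijective hD fun y => ?_
  have := det_eq_of_conj_blockDilation (d := d) (hG.contDiff_inv.continuous_fderiv (by simp))
    (z := y) (tendsto_blockDilation hG.pos y) (fun r hr v => by
      have h1 := ((blockDilationCLM a d r).hasFDerivAt (x := y⁻¹)).comp y (hD y)
      have h2 := (hD (blockDilation d r y)).comp y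
        ((blockDilationCLM a d r).hasFDerivAt (x := y))
      have h3 : (blockDilationCLM a d r) ∘ (fun y : BlockSpace a => y⁻¹) =
          (fun y : BlockSpace a => y⁻¹) ∘ (blockDilationCLM a d r) := by
        funext z
        exact hG.dilation_inv hr z
      rw [h3] at h1
      exact (congrArg (fun L : BlockSpace a →L[ℝ] BlockSpace a => L v) (h1.unique h2)).symm)
  rw [this]
  have hz : (0 : BlockSpace a)⁻¹ = 0 := by rw [← hG.one_eq_zero, inv_one]
  have h0 := hD 0
  have h1 : HasFDerivAt (fun y : BlockSpace a => y⁻¹)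
      (fderiv ℝ (fun y : BlockSpace a => y⁻¹) 0) (0 : BlockSpace a)⁻¹ := by rw [hz]; exact h0
  have h2 := h1.comp (0 : BlockSpace a) h0
  have e : (fun y : BlockSpace a => y⁻¹) ∘ (fun y : BlockSpace a => y⁻¹) = id := by
    funext y; simp
  rw [e] at h2
  have h3 := congrArg ContinuousLinearMap.det (h2.unique (hasFDerivAt_id 0))
  have h4 : (fderiv ℝ (fun y : BlockSpace a => y⁻¹) 0).det *
      (fderiv ℝ (fun y : BlockSpace a => y⁻¹) 0).det = 1 := by
    simpa [ContinuousLinearMap.det, LinearMap.det_comp] using h3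
  rcases mul_self_eq_one_iff.mp h4 with h | h <;> simp [h]

theorem continuous_mul' : Continuous fun z : BlockSpace a × BlockSpace a => z.1 * z.2 :=
  hG.contDiff_mul.continuous

theorem measurableMul₂ : MeasurableMul₂ (BlockSpace a) :=
  ⟨hG.continuous_mul'.measurable⟩

theorem measurableInv : MeasurableInv (BlockSpace a) :=
  ⟨hG.contDiff_inv.continuous.measurable⟩

theorem isMulLeftInvariant : (volume : Measure (BlockSpace a)).IsMulLeftInvariant :=
  ⟨fun x => (hG.measurePreserving_mul_left x).map_eq⟩

theorem isMulRightInvariant : (volume : Measure (BlockSpace a)).IsMulRightInvariant :=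
  ⟨fun x => (hG.measurePreserving_mul_right x).map_eq⟩

theorem isInvInvariant : (volume : Measure (BlockSpace a)).IsInvInvariant :=
  ⟨hG.measurePreserving_inv.map_eq⟩

end IsHomogeneousLaw

end HomogeneousStructure

/-! ### Geometry of rectangles and factorization of their averages. -/

section Rectangles

variable {n : ℕ} {a d : Fin n → ℕ}

/-- The rectangle of size `(2^{e_1}, …, 2^{e_n})`. -/
def dyadicRectangle (a d : Fin n → ℕ) (e : Fin n → ℤ) : Set (BlockSpace a) :=
  blockRectangle a d fun k => (2 : ℝ) ^ e k

theorem dyadicRectangle_mono {e e' : Fin n → ℤ} (h : ∀ k, e k ≤ e' k) :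
    dyadicRectangle a d e ⊆ dyadicRectangle a d e' := fun x hx k =>
  (hx k).trans (pow_le_pow_left₀ (by positivity) (zpow_le_zpow_right₀ (by norm_num) (h k)) _)

theorem blockRectangle_mono {s s' : Fin n → ℝ} (h0 : ∀ k, 0 ≤ s k) (h : ∀ k, s k ≤ s' k) :
    blockRectangle a d s ⊆ blockRectangle a d s' := fun _ hx k =>
  (hx k).trans (pow_le_pow_left₀ (h0 k) (h k) _)

theorem zero_mem_blockRectangle {s : Fin n → ℝ} (hs : ∀ k, 0 ≤ s k) :
    (0 : BlockSpace a) ∈ blockRectangle a d s := fun k => by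
  simpa using pow_nonneg (hs k) _

theorem blockRectangle_eq_pi (s : Fin n → ℝ) : blockRectangle a d s =
    Set.pi Set.univ fun k => Metric.closedBall (0 : EuclideanSpace ℝ (Fin (a k))) (s k ^ d k) := by
  ext x
  simp [blockRectangle]

theorem measurableSet_blockRectangle (s : Fin n → ℝ) : MeasurableSet (blockRectangle a d s) := by
  rw [blockRectangle_eq_pi]
  exact MeasurableSet.univ_pi fun k => measurableSet_closedBall

theorem volume_blockRectangle {s : Fin n → ℝ} (hs : ∀ k, 0 ≤ s k) :
    volume (blockRectangle a d s) = ENNReal.ofReal (∏ k, s k ^ (d k * a k)) *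
      volume (blockRectangle a d fun _ => 1) := by
  rw [blockRectangle_eq_pi, blockRectangle_eq_pi, volume_pi_pi, volume_pi_pi,
    ENNReal.ofReal_prod_of_nonneg fun k _ => pow_nonneg (hs k) _, ← Finset.prod_mul_distrib]
  refine Finset.prod_congr rfl fun k _ => ?_
  rw [Measure.addHaar_closedBall' volume _ (pow_nonneg (hs k) _), one_pow, finrank_euclideanSpace,
    Fintype.card_fin, pow_mul]

theorem volume_unitRectangle_ne_zero : volume (blockRectangle a d fun _ => 1) ≠ 0 := by
  rw [blockRectangle_eq_pi, volume_pi_pi]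
  refine Finset.prod_ne_zero_iff.mpr fun k _ => ?_
  exact (Metric.measure_closedBall_pos volume _ (by simp)).ne'

theorem volume_unitRectangle_ne_top : volume (blockRectangle a d fun _ => 1) ≠ ∞ := by
  rw [blockRectangle_eq_pi, volume_pi_pi]
  exact ENNReal.prod_ne_top fun k _ => measure_closedBall_lt_top.ne

theorem volume_blockRectangle_ne_zero {s : Fin n → ℝ} (hs : ∀ k, 0 < s k) :
    volume (blockRectangle a d s) ≠ 0 := by
  rw [volume_blockRectangle fun k => (hs k).le]
  refine mul_ne_zero ?_ volume_unitRectangle_ne_zero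
  simpa using Finset.prod_pos fun k _ => pow_pos (hs k) _

theorem volume_blockRectangle_ne_top {s : Fin n → ℝ} (hs : ∀ k, 0 ≤ s k) :
    volume (blockRectangle a d s) ≠ ∞ := by
  rw [volume_blockRectangle hs]
  exact ENNReal.mul_ne_top ENNReal.ofReal_ne_top volume_unitRectangle_ne_top

theorem volume_dyadicRectangle (e : Fin n → ℤ) : volume (dyadicRectangle a d e) =
    2 ^ (∑ k, e k * (d k * a k : ℤ)) * volume (blockRectangle a d fun _ => 1) := by
  rw [dyadicRectangle, volume_blockRectangle fun k => by positivity]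
  congr 1
  have h : ∏ k, ((2 : ℝ) ^ e k) ^ (d k * a k) = 2 ^ (∑ k, e k * (d k * a k : ℤ)) := by
    have hz : ∀ (S : Finset (Fin n)) (g : Fin n → ℤ), (2 : ℝ) ^ (∑ k ∈ S, g k) = ∏ k ∈ S, 2 ^ g k := by
      intro S g
      induction S using Finset.cons_induction with
      | empty => simp
      | cons k S hk ih => rw [Finset.sum_cons, Finset.prod_cons, zpow_add₀ (by norm_num), ih]
    rw [hz]
    refine Finset.prod_congr rfl fun k _ => ?_
    rw [← zpow_natCast, ← zpow_mul]
    push_cast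
    rfl
  rw [h, ENNReal.ofReal, Real.toNNReal_zpow (by norm_num), ENNReal.coe_zpow (by simp)]
  simp

theorem volume_dyadicRectangle_add (e : Fin n → ℤ) (c : ℕ) :
    volume (dyadicRectangle a d fun k => e k + c) =
      (2 ^ (c * ∑ k, d k * a k) : ℝ≥0) * volume (dyadicRectangle a d e) := by
  rw [volume_dyadicRectangle, volume_dyadicRectangle, ← mul_assoc]
  congr 1
  have : ∑ k, (e k + c) * (d k * a k : ℤ) =
      ((c * ∑ k, d k * a k : ℕ) : ℤ) + ∑ k, e k * (d k * a k : ℤ) := by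
    push_cast
    rw [Finset.mul_sum, ← Finset.sum_add_distrib]
    exact Finset.sum_congr rfl fun k _ => by ring
  rw [this, ENNReal.zpow_add (by norm_num) (by norm_num), zpow_natCast]
  push_cast
  rfl

theorem volume_dyadicRectangle_ne_zero (e : Fin n → ℤ) : volume (dyadicRectangle a d e) ≠ 0 :=
  volume_blockRectangle_ne_zero fun _ => by positivity

theorem volume_dyadicRectangle_ne_top (e : Fin n → ℤ) : volume (dyadicRectangle a d e) ≠ ∞ :=
  volume_blockRectangle_ne_top fun _ => by positivity

theorem measurableSet_dyadicRectangle (e : Fin n → ℤ) : MeasurableSet (dyadicRectangle a d e) :=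
  measurableSet_blockRectangle _

/-- Dyadic rectangles of monotone size are closed under the group operations, up to enlarging the
exponents by `c`. -/
structure RectangleBound (a d : Fin n → ℕ) [Group (BlockSpace a)] (c : ℕ) : Prop where
  mul_mem : ∀ e : Fin n → ℤ, Monotone e → ∀ x ∈ dyadicRectangle a d e,
    ∀ y ∈ dyadicRectangle a d e, x * y ∈ dyadicRectangle a d fun k => e k + c
  inv_mem : ∀ e : Fin n → ℤ, Monotone e → ∀ x ∈ dyadicRectangle a d e,
    x⁻¹ ∈ dyadicRectangle a d fun k => e k + c

variable [Group (BlockSpace a)]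

/-- To bound block `k`, later blocks may be discarded. Since `e` is monotone, dilating by `2 ^ (-e
k)` brings the remaining blocks into the unit ball, where the group operations are bounded by
compactness. -/
theorem IsHomogeneousLaw.exists_rectangleBound (hG : IsHomogeneousLaw (a := a) d) :
    ∃ c : ℕ, RectangleBound a d c := by
  have hK : IsCompact (Metric.closedBall (0 : BlockSpace a) 1) := isCompact_closedBall 0 1
  obtain ⟨C₁, hC₁⟩ := (hK.prod hK).exists_bound_of_continuousOn hG.continuous_mul'.continuousOn
  obtain ⟨C₂, hC₂⟩ := hK.exists_bound_of_continuousOn hG.contDiff_inv.continuous.continuousOn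
  obtain ⟨c, hc⟩ := pow_unbounded_of_one_lt (max C₁ C₂) (one_lt_two (α := ℝ))
  have hCd : ∀ k, (2 : ℝ) ^ c ≤ (2 ^ c) ^ d k := fun k =>
    le_self_pow₀ (one_le_pow₀ (by norm_num)) (hG.pos k).ne'
  have hsplit : ∀ (e : Fin n → ℤ) k, ((2 : ℝ) ^ (e k + c)) ^ d k =
      ((2 : ℝ) ^ e k) ^ d k * (2 ^ c) ^ d k := by
    intro e k
    rw [zpow_add₀ (by norm_num), zpow_natCast, mul_pow]
  let tr : Fin n → (Fin n → ℤ) → BlockSpace a → BlockSpace a := fun k e x =>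
    blockDilation d ((2 : ℝ) ^ e k)⁻¹ fun i => if i ≤ k then x i else 0
  have htr1 : ∀ (e : Fin n → ℤ) k x, Monotone e → x ∈ dyadicRectangle a d e →
      tr k e x ∈ Metric.closedBall (0 : BlockSpace a) 1 := by
    intro e k x he hx
    rw [mem_closedBall_zero_iff, pi_norm_le_iff_of_nonneg zero_le_one]
    intro i
    by_cases hi : i ≤ k
    · simp only [tr, blockDilation, hi, if_true, norm_smul, norm_pow, norm_inv]
      rw [Real.norm_of_nonneg (by positivity), inv_pow, inv_mul_le_one₀ (by positivity)]
      refine (hx i).trans ?_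
      exact pow_le_pow_left₀ (by positivity) (zpow_le_zpow_right₀ (by norm_num) (he hi)) _
    · simp [tr, blockDilation, hi]
  have htr2 : ∀ (e : Fin n → ℤ) k x, ∀ i ≤ k,
      x i = blockDilation d ((2 : ℝ) ^ e k) (tr k e x) i := by
    intro e k x i hi
    rw [blockDilation_inv_cancel (by positivity)]
    simp [hi]
  refine ⟨c, ⟨fun e he x hx y hy k => ?_, fun e he x hx k => ?_⟩⟩
  · rw [hG.mul_apply_congr (htr2 e k x) (htr2 e k y), ← hG.dilation_mul _ (by positivity)]
    simp only [blockDilation]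
    rw [norm_smul, norm_pow, Real.norm_of_nonneg (by positivity), hsplit]
    gcongr
    refine ((norm_le_pi_norm _ k).trans (hC₁ (tr k e x, tr k e y)
      ⟨htr1 e k x he hx, htr1 e k y he hy⟩)).trans ?_
    exact ((le_max_left _ _).trans hc.le).trans (hCd k)
  · rw [hG.inv_apply_congr (htr2 e k x), ← hG.dilation_inv (by positivity)]
    simp only [blockDilation]
    rw [norm_smul, norm_pow, Real.norm_of_nonneg (by positivity), hsplit]
    gcongr
    refine ((norm_le_pi_norm _ k).trans (hC₂ (tr k e x) (htr1 e k x he hx))).trans ?_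
    exact ((le_max_right _ _).trans hc.le).trans (hCd k)

/-- The exponents `(m, …, m, m + i, …, m + i)`, the first `k` of which are `m`. -/
def twoStepExponent (n k : ℕ) (m : ℤ) (i : ℕ) : Fin n → ℤ := fun j =>
  if (j : ℕ) < k then m else m + i

theorem monotone_ite {k : ℕ} {s t : ℤ} (h : s ≤ t) :
    Monotone fun j : Fin n => if (j : ℕ) < k then s else t := by
  intro i j hij
  have : (i : ℕ) ≤ j := hij
  dsimp only
  split_ifs <;> omega

theorem monotone_twoStepExponent (k : ℕ) (m : ℤ) (i : ℕ) :
    Monotone (twoStepExponent n k m i) := monotone_ite (by omega)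

/-- Taking inverses costs one `c` and each of the two products another, whence `3 * c`. The enlarged
family has the same form with `m` shifted, so it is engulfed in turn, with a constant independent of
`m` and `k`. -/
theorem RectangleBound.engulfing {c : ℕ} (hc : RectangleBound a d c) (k : ℕ) (m : ℤ) :
    Engulfing volume (2 ^ (3 * c * ∑ k, d k * a k))
      (fun i => dyadicRectangle a d (twoStepExponent n k m i))
      (fun i => dyadicRectangle a d (twoStepExponent n k (m + 3 * c) i)) := by
  have e : ∀ i, twoStepExponent n k (m + 3 * c) i =
      fun j => twoStepExponent n k m i j + (3 * c : ℕ) := by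
    intro i
    funext j
    simp only [twoStepExponent]
    split_ifs <;> push_cast <;> ring
  refine ⟨fun i => measurableSet_dyadicRectangle _, fun i i' hi => dyadicRectangle_mono fun j => ?_,
    fun i => ⟨0, zero_mem_blockRectangle fun _ => by positivity⟩,
    fun i => volume_dyadicRectangle_ne_zero _, fun i => volume_dyadicRectangle_ne_top _,
    fun i => volume_dyadicRectangle_ne_zero _, fun i => volume_dyadicRectangle_ne_top _,
    fun i => ?_, fun i x hx y hy z hz => ?_⟩
  · simp only [twoStepExponent]
    split_ifs <;> omega
  · rw [e, volume_dyadicRectangle_add]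
  · have hm := monotone_twoStepExponent (n := n) k m i
    have h1 := hc.mul_mem _ (hm.add_const _) _ (hc.inv_mem _ hm x hx) y
      (dyadicRectangle_mono (fun j => by omega) hy)
    have h2 := hc.mul_mem _ ((hm.add_const _).add_const _) _ h1 z⁻¹
      (dyadicRectangle_mono (fun j => by omega) (hc.inv_mem _ hm z hz))
    rw [e]
    exact dyadicRectangle_mono (fun j => by push_cast; omega) h2

/-- Monotone exponents that are at least `m` and are constant from the `k`-th on. -/
def truncatedExponents (n k : ℕ) (m : ℤ) : Set (Fin n → ℤ) :=
  {e | Monotone e ∧ (∀ j, m ≤ e j) ∧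
    ∃ t, m ≤ t ∧ (∀ j, e j ≤ t) ∧ ∀ j : Fin n, k ≤ j → e j = t}

/-- The inductive step. Up to dilation by powers of `2 ^ c`, the convolution of the indicators of
`R_{e'}` and `R_T` is at least `|R_U|` on `R_e`, and `|R_{e'}| |R_T| = |R_U| |R_e|`. The first
factor is constant from block `k` on; the second is a two-step rectangle. -/
theorem translateAverage_le_familyMaximal_comp (hG : IsHomogeneousLaw (a := a) d) {c : ℕ}
    (hc : RectangleBound a d c) {k : ℕ} (hk : k < n) {m : ℤ} {f : BlockSpace a → ℝ≥0∞}
    (hf : Measurable f) {e : Fin n → ℤ} (he : e ∈ truncatedExponents n (k + 1) m)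
    (x : BlockSpace a) :
    translateAverage volume (dyadicRectangle a d e) f x ≤
      (2 ^ (4 * c * ∑ k, d k * a k) : ℝ≥0) *
      familyMaximal volume (fun e : truncatedExponents n k m => dyadicRectangle a d e)
        (familyMaximal volume
          (fun i => dyadicRectangle a d (twoStepExponent n (k + 1) (m + 3 * c) i)) f) x := by
  obtain ⟨hmono, hm, t, hmt, het, htop⟩ := he
  have := hG.measurableMul₂
  have := hG.measurableInv
  have := hG.isMulLeftInvariant
  have := hG.isMulRightInvariant
  have := hG.isInvInvariant
  set κ : Fin n := ⟨k, hk⟩ with hκ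
  -- `e'` flattens `e` at height `e κ`, `T` carries the top value `t` beyond block `k`, and `U` is
  -- their blockwise minimum.
  set e' : Fin n → ℤ := fun j => min (e j) (e κ) with he'
  set T : Fin n → ℤ := fun j => if (j : ℕ) < k + 1 then m else t with hT
  set U : Fin n → ℤ := fun j => if (j : ℕ) < k + 1 then m else e κ with hU
  have he'm : Monotone e' := fun i j hij => min_le_min_right _ (hmono hij)
  have hTm : Monotone T := monotone_ite hmt
  have hUm : Monotone U := monotone_ite (hm κ)
  have hUe' : ∀ j, U j ≤ e' j := by
    intro j
    simp only [hU, he']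
    split_ifs with hj
    · exact le_min (hm j) (hm κ)
    · exact le_min (hmono (show k ≤ (j : ℕ) by omega)) le_rfl
  have hUT : ∀ j, U j ≤ T j := by
    intro j
    simp only [hU, hT]
    split_ifs
    · exact le_rfl
    · exact het κ
  have hsum : ∀ j, e' j + T j = U j + e j := by
    intro j
    simp only [hU, he', hT]
    split_ifs with hj
    · rw [min_eq_left (hmono (show (j : ℕ) ≤ k by omega)), add_comm]
    · rw [min_eq_right (hmono (show k ≤ (j : ℕ) by omega)), htop j (by omega)]
  have hvol : volume (dyadicRectangle a d fun j => e' j + c) *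
      volume (dyadicRectangle a d fun j => T j + (3 * c : ℕ)) =
      (2 ^ (4 * c * ∑ k, d k * a k) : ℝ≥0) *
        (volume (dyadicRectangle a d U) * volume (dyadicRectangle a d e)) := by
    rw [volume_dyadicRectangle_add, volume_dyadicRectangle_add]
    have h1 : volume (dyadicRectangle a d e') * volume (dyadicRectangle a d T) =
        volume (dyadicRectangle a d U) * volume (dyadicRectangle a d e) := by
      simp only [volume_dyadicRectangle]
      have h2 : ∑ j, e' j * (d j * a j : ℤ) + ∑ j, T j * (d j * a j : ℤ) =
          ∑ j, U j * (d j * a j : ℤ) + ∑ j, e j * (d j * a j : ℤ) := by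
        rw [← Finset.sum_add_distrib, ← Finset.sum_add_distrib]
        exact Finset.sum_congr rfl fun j _ => by rw [← add_mul, hsum, add_mul]
      rw [mul_mul_mul_comm, mul_mul_mul_comm (2 ^ ∑ j, U j * (d j * a j : ℤ)), ← ENNReal.zpow_add (by norm_num) (by norm_num),
        ← ENNReal.zpow_add (by norm_num) (by norm_num), h2]
    rw [← h1, mul_mul_mul_comm, ← ENNReal.coe_mul, ← pow_add]
    congr 3
    ring
  have key : translateAverage volume (dyadicRectangle a d e) f x ≤
      (2 ^ (4 * c * ∑ k, d k * a k) : ℝ≥0) *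
      translateAverage volume (dyadicRectangle a d fun j => e' j + c)
        (translateAverage volume (dyadicRectangle a d fun j => T j + (3 * c : ℕ)) f) x := by
    refine translateAverage_le_comp (u := volume (dyadicRectangle a d U))
      (measurableSet_dyadicRectangle _) (measurableSet_dyadicRectangle _)
      (measurableSet_dyadicRectangle _) (volume_dyadicRectangle_ne_zero _)
      (volume_dyadicRectangle_ne_top _) (volume_dyadicRectangle_ne_zero _)
      (volume_dyadicRectangle_ne_top _) hvol.le (fun w hw => ?_) hf x
    -- Cutting off `w` after block `k` splits it as `(w v⁻¹) v`. By triangularity `w v⁻¹` vanishes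
    -- in blocks up to `k`, so it fits into the small initial sides of `R_T`.
    set v : BlockSpace a := fun j => if (j : ℕ) < k + 1 then w j else 0 with hv
    have hve' : v ∈ dyadicRectangle a d e' := by
      intro j
      simp only [hv]
      split_ifs with hj
      · have : e' j = e j := min_eq_left (hmono (show (j : ℕ) ≤ k by omega))
        rw [this]
        exact hw j
      · rw [norm_zero]
        positivity
    have hve : v ∈ dyadicRectangle a d e := dyadicRectangle_mono (fun j => min_le_left _ _) hve'
    have hwv : w * v⁻¹ ∈ dyadicRectangle a d fun j => T j + (2 * c : ℕ) := by
      have h1 := hc.mul_mem _ (hmono.add_const _) w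
        (dyadicRectangle_mono (fun j => by omega) hw) _ (hc.inv_mem _ hmono v hve)
      intro j
      by_cases hj : (j : ℕ) < k + 1
      · have h2 : (w * v⁻¹) j = (v * v⁻¹) j := by
          refine hG.mul_apply_congr (fun i hi => ?_) fun _ _ => rfl
          have : (i : ℕ) ≤ j := hi
          simp only [hv, if_pos (show (i : ℕ) < k + 1 by omega)]
        rw [h2, mul_inv_cancel, hG.one_eq_zero, Pi.zero_apply, norm_zero]
        positivity
      · have h2 : T j + (2 * c : ℕ) = e j + c + c := by
          simp only [hT, hj, if_false]
          rw [htop j (by omega)]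
          push_cast
          ring
        exact (h1 j).trans_eq (congrArg (fun z : ℤ => ((2 : ℝ) ^ z) ^ d j) h2.symm)
    have hmeas : volume ((fun y => y * v⁻¹) ⁻¹' dyadicRectangle a d U) =
        volume (dyadicRectangle a d U) := measure_preimage_mul_right _ _ _
    -- The admissible `y` contain the right translate `R_U v`, which has the measure of `R_U`.
    rw [← hmeas]
    refine measure_mono fun y hy => ⟨?_, ?_⟩
    · have := hc.mul_mem _ he'm _ (dyadicRectangle_mono hUe' hy) v hve'
      simpa using this
    · have h1 := hc.inv_mem _ hUm _ hy
      have h2 := hc.mul_mem _ (hTm.add_const _) _ hwv _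
        (dyadicRectangle_mono (fun j => by have := hUT j; push_cast; omega) h1)
      have h3 : w * v⁻¹ * (y * v⁻¹)⁻¹ = w * y⁻¹ := by group
      rw [h3] at h2
      exact dyadicRectangle_mono (fun j => by push_cast; omega) h2
  refine key.trans (mul_le_mul_right ?_ _)
  have hmem : (fun j => e' j + (c : ℤ)) ∈ truncatedExponents n k m := by
    refine ⟨he'm.add_const _, fun j => ?_, e κ + c, ?_, fun j => ?_, fun j hj => ?_⟩
    · have : m ≤ e' j := le_min (hm j) (hm κ)
      dsimp only
      omega
    · have := hm κ
      omega
    · have : e' j ≤ e κ := min_le_right _ _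
      dsimp only
      omega
    · have : e' j = e κ := min_eq_right (hmono (show k ≤ (j : ℕ) from hj))
      dsimp only
      omega
  refine (translateAverage_mono (fun y => ?_) x).trans
    (le_iSup (fun e : truncatedExponents n k m => translateAverage volume (dyadicRectangle a d e)
      (familyMaximal volume _ f) x) ⟨_, hmem⟩)
  have hTi : (fun j => T j + ((3 * c : ℕ) : ℤ)) =
      twoStepExponent n (k + 1) (m + 3 * c) (t - m).toNat := by
    funext j
    simp only [hT, twoStepExponent]
    split_ifs <;> push_cast <;> omega
  rw [hTi]
  exact le_iSup (fun i => translateAverage volume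
    (dyadicRectangle a d (twoStepExponent n (k + 1) (m + 3 * c) i)) f y) _

end Rectangles

/-! ### Iteration, passage to all acceptable sizes, and measurability. -/

section Assembly

open Filter Topology

theorem SquareBound.comp_of_le {α : Type*} [MeasurableSpace α] {μ : Measure α} {p : ℝ}
    (hp : 0 ≤ p) {C C' K : ℝ≥0} {S T T' : (α → ℝ≥0∞) → α → ℝ≥0∞} (hT' : SquareBound μ p C' T')
    (hS : SquareBound μ p C S) (hSm : ∀ f, Measurable f → Measurable (S f))
    (h : ∀ f, Measurable f → ∀ x, T f x ≤ K * T' (S f) x) :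
    SquareBound μ p (K ^ p * (C' * C)) T := by
  intro f hf
  have hp2 : 0 ≤ p / 2 := by linarith
  have e : ∀ x, (∑' j, (K * T' (S (f j)) x) ^ 2) ^ (p / 2) =
      (K : ℝ≥0∞) ^ p * (∑' j, T' (S (f j)) x ^ 2) ^ (p / 2) := by
    intro x
    simp_rw [mul_pow]
    rw [ENNReal.tsum_mul_left, ENNReal.mul_rpow_of_nonneg _ _ hp2, ← ENNReal.rpow_natCast,
      ← ENNReal.rpow_mul]
    congr 2
    push_cast
    ring
  calc _ ≤ ∫⁻ x, (∑' j, (K * T' (S (f j)) x) ^ 2) ^ (p / 2) ∂μ := by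
        refine lintegral_mono fun x => ENNReal.rpow_le_rpow (ENNReal.tsum_le_tsum fun j => ?_) hp2
        exact pow_le_pow_left₀ zero_le (h _ (hf j) x) 2
    _ = (K : ℝ≥0∞) ^ p * ∫⁻ x, (∑' j, T' (S (f j)) x ^ 2) ^ (p / 2) ∂μ := by
        simp_rw [e]
        exact lintegral_const_mul' _ _ (ENNReal.rpow_ne_top_of_nonneg hp ENNReal.coe_ne_top)
    _ ≤ (K : ℝ≥0∞) ^ p * (C' * (C * ∫⁻ x, (∑' j, f j x ^ 2) ^ (p / 2) ∂μ)) := by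
        gcongr
        exact (hT' _ fun j => hSm _ (hf j)).trans (by gcongr; exact hS f hf)
    _ = _ := by
        rw [ENNReal.coe_mul, ENNReal.coe_mul, ENNReal.coe_rpow_of_nonneg _ hp]
        ring

theorem SquareBound.id {α : Type*} [MeasurableSpace α] {μ : Measure α} {p : ℝ} :
    SquareBound μ p 1 (fun f => f) := fun f _ => by simp

theorem SquareBound.of_le_mul {α : Type*} [MeasurableSpace α] {μ : Measure α} {p : ℝ}
    (hp : 0 ≤ p) {C K : ℝ≥0} {T T' : (α → ℝ≥0∞) → α → ℝ≥0∞} (hT' : SquareBound μ p C T')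
    (h : ∀ f, Measurable f → ∀ x, T f x ≤ K * T' f x) :
    SquareBound μ p (K ^ p * C) T := by
  simpa using hT'.comp_of_le hp SquareBound.id (fun _ hf => hf) h

/-- Monotone convergence for `L^p(ℓ²)` bounds. -/
theorem SquareBound.iSup {α : Type*} [MeasurableSpace α] {μ : Measure α} {p : ℝ}
    (hp : 0 < p) {C : ℝ≥0} {T : ℕ → (α → ℝ≥0∞) → α → ℝ≥0∞}
    (hT : ∀ L, SquareBound μ p C (T L)) (hTm : ∀ L f, Measurable f → Measurable (T L f))
    (hmono : ∀ f x, Monotone fun L => T L f x) :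
    SquareBound μ p C (fun f x => ⨆ L, T L f x) := by
  intro f hf
  have hp2 : 0 < p / 2 := by linarith
  have e : ∀ x, (∑' j, (⨆ L, T L (f j) x) ^ 2) ^ (p / 2) =
      ⨆ L, (∑' j, T L (f j) x ^ 2) ^ (p / 2) := by
    intro x
    have e1 : ∀ j, (⨆ L, T L (f j) x) ^ 2 = ⨆ L, T L (f j) x ^ 2 := by
      intro j
      simp_rw [← ENNReal.rpow_two]
      exact (ENNReal.orderIsoRpow 2 two_pos).map_iSup _
    have e2 : ∑' j, ⨆ L, T L (f j) x ^ 2 = ⨆ L, ∑' j, T L (f j) x ^ 2 := by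
      simp_rw [← lintegral_count]
      exact lintegral_iSup (fun L => measurable_from_nat)
        fun L L' h j => pow_le_pow_left₀ zero_le (hmono (f j) x h) 2
    simp_rw [e1]
    rw [e2]
    exact (ENNReal.orderIsoRpow (p / 2) hp2).map_iSup _
  simp_rw [e]
  have hm : ∀ L j, Measurable (T L (f j)) := fun L j => hTm L _ (hf j)
  rw [lintegral_iSup (fun L => by fun_prop) fun L L' h x =>
    ENNReal.rpow_le_rpow (ENNReal.tsum_le_tsum fun j =>
      pow_le_pow_left₀ zero_le (hmono (f j) x h) 2) hp2.le]
  exact iSup_le fun L => hT L f hf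

theorem eLpNorm_le_of_lintegral_rpow_le {α : Type*} [MeasurableSpace α] {μ : Measure α}
    {p : ℝ≥0∞} (hp0 : p ≠ 0) (hpt : p ≠ ∞) {C : ℝ≥0} {ε : Type*} [ENorm ε] {F : α → ℝ≥0∞}
    {F' : α → ε}
    (h : ∫⁻ x, F x ^ p.toReal ∂μ ≤ C * ∫⁻ x, ‖F' x‖ₑ ^ p.toReal ∂μ) :
    eLpNorm F p μ ≤ (C ^ (1 / p.toReal) : ℝ≥0) * eLpNorm F' p μ := by
  have hp : 0 ≤ 1 / p.toReal := by positivity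
  rw [eLpNorm_eq_lintegral_rpow_enorm_toReal hp0 hpt, eLpNorm_eq_lintegral_rpow_enorm_toReal hp0 hpt,
    ENNReal.coe_rpow_of_nonneg _ hp, ← ENNReal.mul_rpow_of_nonneg _ _ hp]
  simp only [enorm_eq_self]
  gcongr

variable {n : ℕ} {a d : Fin n → ℕ} [Group (BlockSpace a)]

/-- Induction on the number of blocks left free. For `k = 0` the exponents are constant and form one
nested sequence; each further block composes with one more two-step maximal operator. Choosing the
constant before `m` is what allows `m → -∞` later. -/
theorem exists_squareBound_truncatedExponents (hG : IsHomogeneousLaw (a := a) d) {p : ℝ}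
    (hp : 1 < p) {k : ℕ} (hk : k ≤ n) : ∃ C : ℝ≥0, ∀ m : ℤ, SquareBound volume p C
      (familyMaximal volume fun e : truncatedExponents n k m => dyadicRectangle a d e) := by
  have := hG.measurableMul₂
  have := hG.measurableInv
  have := hG.isMulLeftInvariant
  have := hG.isInvInvariant
  obtain ⟨c, hc⟩ := hG.exists_rectangleBound
  obtain ⟨C₀, hC₀⟩ := Engulfing.exists_squareBound (μ := (volume : Measure (BlockSpace a))) hp
    (2 ^ (3 * c * ∑ k, d k * a k))
  have hp0 : 0 ≤ p := by linarith
  induction k with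
  | zero =>
    refine ⟨1 ^ p * C₀, fun m => (hC₀ _ _ _ (hc.engulfing 0 m) (hc.engulfing 0 _)).of_le_mul hp0
      fun f _ x => ?_⟩
    rw [ENNReal.coe_one, one_mul]
    refine iSup_le fun ⟨e, _, _, t, hmt, _, ht⟩ => ?_
    have : e = twoStepExponent n 0 m (t - m).toNat := by
      funext j
      simp only [twoStepExponent, Nat.not_lt_zero, if_false]
      rw [ht j (Nat.zero_le _)]
      omega
    simp only [this]
    exact le_iSup (fun i => translateAverage volume (dyadicRectangle a d (twoStepExponent n 0 m i)) f x) _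
  | succ k ih =>
    obtain ⟨C, hC⟩ := ih (by omega)
    exact ⟨_, fun m => (hC m).comp_of_le hp0
      (hC₀ _ _ _ (hc.engulfing (k + 1) (m + 3 * c)) (hc.engulfing (k + 1) _))
      (fun f hf => measurable_familyMaximal _ hf) fun f hf x => iSup_le fun e =>
        translateAverage_le_familyMaximal_comp hG hc hk hf e.2 x⟩

/-- At `k = n` the constancy condition is void, so the families with lower bound `-L` increase to
all monotone exponents. -/
theorem exists_squareBound_dyadicRectangle (hG : IsHomogeneousLaw (a := a) d) {p : ℝ}
    (hp : 1 < p) : ∃ C : ℝ≥0, SquareBound volume p C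
      (familyMaximal volume fun e : {e : Fin n → ℤ // Monotone e} => dyadicRectangle a d e) := by
  have := hG.measurableMul₂
  have := hG.measurableInv
  obtain ⟨C, hC⟩ := exists_squareBound_truncatedExponents hG hp le_rfl
  have hmono : ∀ (f : BlockSpace a → ℝ≥0∞) x, Monotone fun L : ℕ =>
      familyMaximal volume (fun e : truncatedExponents n n (-L) => dyadicRectangle a d e) f x := by
    intro f x L L' h
    refine iSup_le fun ⟨e, h1, h2, t, h3, h4, h5⟩ => ?_
    exact le_iSup (fun e : truncatedExponents n n (-(L' : ℤ)) =>
      translateAverage volume (dyadicRectangle a d e) f x)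
      ⟨e, h1, fun j => by have := h2 j; omega, t, by omega, h4, h5⟩
  have h := SquareBound.iSup (by linarith) (fun L : ℕ => hC (-L))
    (fun L f hf => measurable_familyMaximal _ hf) hmono
  refine ⟨_, h.of_le_mul (K := 1) (by linarith) fun f _ x => iSup_le fun ⟨e, he⟩ => ?_⟩
  rw [ENNReal.coe_one, one_mul]
  set L : ℕ := ∑ j, (e j).natAbs with hL
  have hle : ∀ j, (e j).natAbs ≤ L := fun j =>
    Finset.single_le_sum (f := fun j => (e j).natAbs) (fun _ _ => Nat.zero_le _) (Finset.mem_univ j)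
  refine le_trans ?_ (le_iSup _ L)
  exact le_iSup (fun e : truncatedExponents n n (-(L : ℤ)) =>
      translateAverage volume (dyadicRectangle a d e) f x)
      ⟨e, he, fun j => by have := hle j; omega, L, by omega, fun j => by have := hle j; omega,
        fun j hj => absurd j.2 (by omega)⟩

/-- The maximal function over all rectangles of acceptable size. -/
noncomputable def rectangleMaximal (d : Fin n → ℕ) (f : BlockSpace a → ℝ≥0∞) (x : BlockSpace a) :
    ℝ≥0∞ :=
  ⨆ (s : Fin n → ℝ) (_ : IsAcceptable s), translateAverage volume (blockRectangle a d s) f x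

/-- Rounding each side up to a power of two preserves the order of the sides and at most doubles
each `s k`. -/
theorem rectangleMaximal_le_dyadic (f : BlockSpace a → ℝ≥0∞) (x : BlockSpace a) :
    rectangleMaximal d f x ≤ (2 ^ (∑ k, d k * a k) : ℝ≥0) *
      familyMaximal volume (fun e : {e : Fin n → ℤ // Monotone e} => dyadicRectangle a d e) f x := by
  refine iSup₂_le fun s ⟨hs, hsm⟩ => ?_
  set e : Fin n → ℤ := fun k => Int.clog 2 (s k) with he
  have hem : Monotone e := fun i j hij => Int.clog_mono_right (hs i) (hsm hij)
  have h1 : ∀ k, s k ≤ (2 : ℝ) ^ e k := fun k => Int.self_le_zpow_clog one_lt_two (s k)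
  have h2 : ∀ k, (2 : ℝ) ^ e k ≤ 2 * s k := by
    intro k
    have := Int.zpow_pred_clog_lt_self (R := ℝ) one_lt_two (hs k)
    rw [Nat.cast_ofNat, zpow_sub_one₀ two_ne_zero] at this
    simp only [he]
    linarith
  have hvol : volume (dyadicRectangle a d e) ≤
      (2 ^ (∑ k, d k * a k) : ℝ≥0) * volume (blockRectangle a d s) := by
    rw [dyadicRectangle, volume_blockRectangle fun k => by positivity,
      volume_blockRectangle fun k => (hs k).le, ← mul_assoc]
    gcongr
    rw [← ENNReal.ofReal_coe_nnreal, ← ENNReal.ofReal_mul (by positivity)]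
    refine ENNReal.ofReal_le_ofReal ?_
    push_cast
    rw [← Finset.prod_pow_eq_pow_sum, ← Finset.prod_mul_distrib]
    refine Finset.prod_le_prod (fun k _ => by positivity) fun k _ => ?_
    rw [← mul_pow]
    exact pow_le_pow_left₀ (by positivity) (h2 k) _
  refine (translateAverage_le_of_subset (blockRectangle_mono (fun k => (hs k).le) h1)
    (volume_blockRectangle_ne_zero hs) (volume_dyadicRectangle_ne_top e) hvol f x).trans ?_
  exact mul_le_mul_right (le_iSup (fun e : {e : Fin n → ℤ // Monotone e} =>
    translateAverage volume (dyadicRectangle a d e) f x) ⟨e, hem⟩) _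

theorem exists_squareBound_rectangleMaximal (hG : IsHomogeneousLaw (a := a) d) {p : ℝ}
    (hp : 1 < p) : ∃ C : ℝ≥0, SquareBound (α := BlockSpace a) volume p C (rectangleMaximal d) := by
  obtain ⟨C, hC⟩ := exists_squareBound_dyadicRectangle hG hp
  exact ⟨_, hC.of_le_mul (by linarith) fun f _ x => rectangleMaximal_le_dyadic f x⟩

/-- Reduction to a countable supremum, needed for measurability. -/
theorem rectangleMaximal_eq_iSup_rat (f : BlockSpace a → ℝ≥0∞) (x : BlockSpace a) :
    rectangleMaximal d f x =
      familyMaximal volume (fun q : {q : Fin n → ℚ // IsAcceptable fun k => (q k : ℝ)} =>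
        blockRectangle a d fun k => (q.1 k : ℝ)) f x := by
  refine le_antisymm (iSup₂_le fun s ⟨hs, hsm⟩ => ?_) (iSup_le fun q =>
    le_iSup₂_of_le (fun k => (q.1 k : ℝ)) q.2 le_rfl)
  set S := familyMaximal volume (fun q : {q : Fin n → ℚ // IsAcceptable fun k => (q k : ℝ)} =>
        blockRectangle a d fun k => (q.1 k : ℝ)) f x with hS
  -- Rounding up to multiples of `1 / (m + 1)` preserves monotonicity and gives rectangles
  -- containing `R_s` whose volumes tend to that of `R_s`.
  let q : ℕ → Fin n → ℚ := fun m k => (⌈s k * (m + 1)⌉ : ℚ) / (m + 1)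
  have hq1 : ∀ m k, s k ≤ (q m k : ℝ) := by
    intro m k
    have : (0 : ℝ) < m + 1 := by positivity
    simp only [q]
    push_cast
    rw [le_div_iff₀ this]
    exact Int.le_ceil _
  have hq2 : ∀ m k, (q m k : ℝ) ≤ s k + 1 / ((m : ℝ) + 1) := by
    intro m k
    have : (0 : ℝ) < m + 1 := by positivity
    simp only [q]
    push_cast
    rw [div_le_iff₀ this, add_mul, one_div_mul_cancel this.ne']
    exact (Int.ceil_lt_add_one _).le
  have hqa : ∀ m, IsAcceptable fun k => (q m k : ℝ) := by
    refine fun m => ⟨fun k => (hs k).trans_le (hq1 m k), fun i j hij => ?_⟩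
    simp only [q]
    push_cast
    have := hsm hij
    gcongr
  have hlim : ∀ k, Tendsto (fun m => (q m k : ℝ)) atTop (𝓝 (s k)) := by
    intro k
    refine tendsto_of_tendsto_of_tendsto_of_le_of_le tendsto_const_nhds ?_ (fun m => hq1 m k)
      (fun m => hq2 m k)
    simpa using tendsto_one_div_add_atTop_nhds_zero_nat.const_add (s k)
  have hv : Tendsto (fun m => volume (blockRectangle a d fun k => (q m k : ℝ)) /
      volume (blockRectangle a d s)) atTop (𝓝 1) := by
    have h0 := volume_blockRectangle_ne_zero (a := a) (d := d) hs
    have ht := volume_blockRectangle_ne_top (a := a) (d := d) fun k => (hs k).le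
    rw [← ENNReal.div_self h0 ht]
    refine ENNReal.Tendsto.div_const ?_ (.inl h0)
    rw [volume_blockRectangle fun k => (hs k).le]
    simp_rw [volume_blockRectangle fun k => ((hqa _).1 k).le]
    refine ENNReal.Tendsto.mul_const ?_ (.inr volume_unitRectangle_ne_top)
    exact ENNReal.tendsto_ofReal (tendsto_finsetProd _ fun k _ => (hlim k).pow _)
  have h1 : ∀ m, translateAverage volume (blockRectangle a d s) f x ≤
      volume (blockRectangle a d fun k => (q m k : ℝ)) / volume (blockRectangle a d s) * S := by
    intro m
    have h0 := volume_blockRectangle_ne_zero (a := a) (d := d) hs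
    have ht := volume_blockRectangle_ne_top (a := a) (d := d) fun k => (hs k).le
    refine (translateAverage_le_of_subset (blockRectangle_mono (fun k => (hs k).le) (hq1 m)) h0
      (volume_blockRectangle_ne_top fun k => ((hqa m).1 k).le)
      (ENNReal.div_mul_cancel h0 ht).ge f x).trans ?_
    exact mul_le_mul_right (le_iSup (fun q : {q : Fin n → ℚ // IsAcceptable fun k => (q k : ℝ)} =>
      translateAverage volume (blockRectangle a d fun k => (q.1 k : ℝ)) f x) ⟨q m, hqa m⟩) _
  have h2 := ENNReal.Tendsto.mul_const (b := S) hv (.inl one_ne_zero)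
  rw [one_mul] at h2
  exact ge_of_tendsto' h2 h1

theorem measurable_rectangleMaximal (hG : IsHomogeneousLaw (a := a) d) {f : BlockSpace a → ℝ≥0∞}
    (hf : Measurable f) : Measurable (rectangleMaximal d f) := by
  have := hG.measurableMul₂
  have := hG.measurableInv
  rw [funext (rectangleMaximal_eq_iSup_rat f)]
  exact measurable_familyMaximal _ hf

/-- The map `y ↦ x y⁻¹` preserves measure for every `x`, so null sets affect no average. Equality
thus holds everywhere, and measurable representatives may be used. -/
theorem rectangleMaximal_congr_ae (hG : IsHomogeneousLaw (a := a) d) {f g : BlockSpace a → ℝ≥0∞}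
    (h : f =ᵐ[volume] g) : rectangleMaximal d f = rectangleMaximal d g := by
  have := hG.measurableMul₂
  have := hG.measurableInv
  have := hG.isMulLeftInvariant
  have := hG.isInvInvariant
  funext x
  unfold rectangleMaximal translateAverage
  have h1 := (Measure.measurePreserving_div_left volume x).quasiMeasurePreserving.ae_eq_comp h
  refine iSup_congr fun s => iSup_congr fun _ => congrArg _
    (lintegral_congr_ae (ae_restrict_of_ae ?_))
  simpa [Function.comp_def, div_eq_mul_inv, Filter.EventuallyEq] using h1

theorem rectangleMaximal_zero (x : BlockSpace a) : rectangleMaximal d (fun _ => 0) x = 0 := by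
  simp [rectangleMaximal, translateAverage]

/-- The scalar bound is the square function bound for a sequence with one nonzero term. -/
theorem lintegral_rectangleMaximal_rpow_le {p : ℝ} {C : ℝ≥0}
    (hC : SquareBound (α := BlockSpace a) volume p C (rectangleMaximal d))
    {f : BlockSpace a → ℝ≥0∞} (hf : Measurable f) :
    ∫⁻ x, rectangleMaximal d f x ^ p ≤ C * ∫⁻ x, f x ^ p := by
  have h := hC (fun j => if j = 0 then f else fun _ => 0) fun j => by
    split_ifs
    · exact hf
    · exact measurable_const
  have e : ∀ y : ℝ≥0∞, (y ^ 2) ^ (p / 2) = y ^ p := by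
    intro y
    rw [← ENNReal.rpow_natCast, ← ENNReal.rpow_mul]
    congr 1
    push_cast
    ring
  have e1 : ∀ x, ∑' j : ℕ, rectangleMaximal d (if j = 0 then f else fun _ => 0) x ^ 2 =
      rectangleMaximal d f x ^ 2 := by
    intro x
    rw [tsum_eq_single 0 fun j hj => by simp [hj, rectangleMaximal_zero]]
    simp
  have e2 : ∀ x, ∑' j : ℕ, (if j = 0 then f else fun _ => 0) x ^ 2 = f x ^ 2 := by
    intro x
    rw [tsum_eq_single 0 fun j hj => by simp [hj]]
    simp
  simpa only [e1, e2, e] using h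

end Assembly

theorem mainTheorem8 {𝕜 : Type*} [RCLike 𝕜] {n : ℕ} (a d : Fin n → ℕ)
    (ha : ∀ k, 0 < a k) (hd : ∀ k, 0 < d k) (hd_mono : Monotone d)
    (G : HomogeneousGroup a d) (p : ℝ≥0∞) (hp_one : 1 < p) (hp_top : p < ⊤) :
    ((∀ f g : BlockSpace a → 𝕜, f =ᵐ[volume] g →
        G.maximalFunction f = G.maximalFunction g) ∧
      ∃ A : ℝ≥0, ∀ f : BlockSpace a → 𝕜, MemLp f p volume →
        MemLp (G.maximalFunction f) p volume ∧
        eLpNorm (G.maximalFunction f) p volume ≤ A * eLpNorm f p volume) ∧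
    (∃ A : ℝ≥0, ∀ f : ℕ → BlockSpace a → 𝕜,
      (∀ j, AEStronglyMeasurable (f j) volume) →
        eLpNorm (fun x => (∑' j, G.maximalFunction (f j) x ^ 2) ^ (1 / 2 : ℝ)) p volume ≤
          A * eLpNorm (fun x => (∑' j, ‖f j x‖ₑ ^ 2) ^ (1 / 2 : ℝ)) p volume) := by
  let _ : Group (BlockSpace a) := G.toGroup
  have hG : IsHomogeneousLaw (a := a) d :=
    ⟨G.contDiff_mul, G.contDiff_inv, G.dilation_mul, hd, hd_mono⟩
  have hM : ∀ f : BlockSpace a → 𝕜, G.maximalFunction f = rectangleMaximal d fun x => ‖f x‖ₑ :=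
    fun _ => rfl
  have hp0 : p ≠ 0 := (zero_lt_one.trans hp_one).ne'
  have hp : 1 < p.toReal := by
    rw [← ENNReal.toReal_one]
    exact (ENNReal.toReal_lt_toReal ENNReal.one_ne_top hp_top.ne).mpr hp_one
  obtain ⟨C, hC⟩ := exists_squareBound_rectangleMaximal hG hp
  have hcongr : ∀ f g : BlockSpace a → 𝕜, f =ᵐ[volume] g →
      G.maximalFunction f = G.maximalFunction g := fun f g h => by
    rw [hM, hM]
    exact rectangleMaximal_congr_ae hG (h.fun_comp fun y => ‖y‖ₑ)
  refine ⟨⟨hcongr, C ^ (1 / p.toReal), fun f hf => ?_⟩, C ^ (1 / p.toReal), fun f hf => ?_⟩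
  · have hfm : AEStronglyMeasurable f volume := hf.aestronglyMeasurable
    have hle : eLpNorm (G.maximalFunction f) p volume ≤
        (C ^ (1 / p.toReal) : ℝ≥0) * eLpNorm f p volume := by
      rw [hcongr _ _ hfm.ae_eq_mk, eLpNorm_congr_ae hfm.ae_eq_mk, hM]
      exact eLpNorm_le_of_lintegral_rpow_le hp0 hp_top.ne
        (lintegral_rectangleMaximal_rpow_le hC hfm.stronglyMeasurable_mk.enorm)
    refine ⟨⟨?_, hle.trans_lt (ENNReal.mul_lt_top ENNReal.coe_lt_top hf.eLpNorm_lt_top)⟩, hle⟩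
    rw [hcongr _ _ hfm.ae_eq_mk, hM]
    exact (measurable_rectangleMaximal hG hfm.stronglyMeasurable_mk.enorm).aestronglyMeasurable
  · have e : ∀ y : ℝ≥0∞, (y ^ (1 / 2 : ℝ)) ^ p.toReal = y ^ (p.toReal / 2) := by
      intro y
      rw [← ENNReal.rpow_mul]
      congr 1
      ring
    have hae : (fun x => (∑' j, ‖f j x‖ₑ ^ 2) ^ (1 / 2 : ℝ)) =ᵐ[volume]
        fun x => (∑' j, ‖(hf j).mk (f j) x‖ₑ ^ 2) ^ (1 / 2 : ℝ) := by
      filter_upwards [ae_all_iff.mpr fun j => (hf j).ae_eq_mk] with x hx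
      simp_rw [hx]
    rw [eLpNorm_congr_ae hae]
    have hM' : ∀ j, G.maximalFunction (f j) =
        rectangleMaximal d fun x => ‖(hf j).mk (f j) x‖ₑ := fun j => by
      rw [hcongr _ _ (hf j).ae_eq_mk, hM]
    simp_rw [hM']
    refine eLpNorm_le_of_lintegral_rpow_le hp0 hp_top.ne ?_
    simp only [enorm_eq_self, e]
    exact hC _ fun j => (hf j).stronglyMeasurable_mk.enorm
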